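/- **Conventions.** A *resolution graph* is a finite tree $\Gamma$ with vertex set $\mathcal V$ and Euler numbers $e_v\in\mathbb Z$ (all genera zero) whose intersection form $(\,,)$ on $L=\mathbb Z\langle E_v\rangle_{v\in\mathcal V}$, given by $(E_v,E_v)=e_v$, $(E_v,E_w)=1$ if $v,w$ are adjacent and $0$ otherwise, is negative definite. Cycles $\sum_v x_vE_v$ are compared coefficientwise, $|x|=\{v: x_v\neq0\}$, $E=\sum_vE_v$, $\delta_v$ is the valency of $v$, and $L'=\{x\in L\otimes\mathbb Q:(x,L)\subset\mathbb Z\}$ has the basis $E^*_v$ with $(E_v^*,E_w)=-1$ if $v=w$ and $0$ otherwise. Let $Z_K\in L'$ be given by $(Z_K,E_v)=e_v+2$ for all $v$, and $\chi(x)=-(x,x-Z_K)/2$. Let $\mathcal S'=\{x\in L':(x,E_v)\le 0\ \forall v\}$, let $s_{[Z_K]}$ be the least element of $\mathcal S'\cap(Z_K+L)$, and $Z_{min}$ the least element of $(\mathcal S'\cap L)\setminus\{0\}$. The graph is *elliptic* if moreover $e_v\le-2$ for all $v$ and $\min\{\chi(l): l\in L,\ l>0\}=0$. *Elliptic sequence.*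 For $\Gamma$ elliptic put $B_{-1}=\Gamma$ and $x_0=Z_K-s_{[Z_K]}$, and, as long as $x_k\ne0$, $B_k=|x_k|$ and $x_{k+1}=x_k-Z_{min}(B_k)$, where $Z_{min}(B_k)$ is the minimal cycle of the full subgraph $B_k$. This gives the NN-elliptic sequence $B_{-1}\supseteq B_0\supsetneq B_1\supsetneq\dots\supsetneq B_m$. *Canonical polynomial.* Let $\sum_{x\in L'}z(x)\mathbf t^x$ be the Taylor expansion at the origin of $\prod_v(1-\mathbf t^{E_v^*})^{\delta_v-2}$. Put $P_0^\Gamma(\mathbf t)=\sum_{l}w(l)\,\mathbf t^{l}$ with $w(l)=z(Z_K-E-l)$, the sum being over those $l\in L$ that have at least one coefficient $l_v\ge0$; this is a Laurent polynomial. Its exponents are the $l$ in this range with $w(l)\neq0$. For $0\le i\le m$ let $\mathcal F_iP_0^\Gamma$ be the sum of the monomials $w(l)\mathbf t^l$ of $P_0^\Gamma$ with $l_v<0$ for all $v\in\Gamma\setminus B_i$. *Extensions.* Let $\Gamma'\subseteq\Gamma$ be a full subgraph (with the same Euler numbers) such that both $\Gamma$ and $\Gamma'$ are elliptic. The *index*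 of the extension is the integer $i\in\{0,\dots,m\}$ such that $\Gamma',B_i^\Gamma,B_{i+1}^\Gamma,\dots,B_m^\Gamma$ is the NN-elliptic sequence of $\Gamma'$. The extension is *good* if for each exponent $l'$ of $P_0^{\Gamma'}$ there is an exponent $l$ of $P_0^\Gamma$ with $l|_{\Gamma'}=l'$. Write $P(\mathbf t_{\Gamma'})$ for the result of setting $t_v=1$ for all $v\notin\Gamma'$ in $P$. **Theorem.** Let $\Gamma'\subseteq\Gamma$ be elliptic graphs as above, and assume that each vertex of $\Gamma'$ that has a neighbour in $\Gamma\setminus\Gamma'$ is an end-vertex of $\Gamma'$ (it has valency $1$ in $\Gamma'$). Then the index $i$ of the extension exists and is unique, and the extension $\Gamma'\subseteq\Gamma$ is good if and only if $$\mathcal F_{i}P_0^{\Gamma}(\mathbf t_{\Gamma'})=P_0^{\Gamma'}(\mathbf t).$$ -/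

import Mathlib

noncomputable section

open Matrix

/-- A plumbing graph (all genus decorations are zero): a graph whose vertices carry Euler numbers. -/
structure PlumbingGraph (V : Type*) where
  graph : SimpleGraph V
  /-- the Euler number `e_v = (E_v, E_v)` -/
  euler : V → ℤ

namespace PlumbingGraph

/-- The full subgraph on the vertex set `S`, with the same Euler numbers. -/
def fullSubgraph {V : Type*} (Γ : PlumbingGraph V) (S : Finset V) : PlumbingGraph S where
  graph := Γ.graph.comap Subtype.val
  euler v := Γ.euler v

open Classical in
/-- The intersection matrix `((E_v, E_w))_{v, w}`. -/
def intersectionMatrix {V : Type*} (Γ : PlumbingGraph V) : Matrix V V ℚ :=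
  Matrix.of fun v w => if v = w then (Γ.euler v : ℚ) else if Γ.graph.Adj v w then 1 else 0

/-- The intersection form on `L ⊗ ℚ`. A cycle `∑ x_v E_v` is given by its coefficients `x_v`. -/
def form {V : Type*} [Fintype V] (Γ : PlumbingGraph V) (x y : V → ℚ) : ℚ :=
  x ⬝ᵥ (Γ.intersectionMatrix *ᵥ y)

open Classical in
/-- The basis element `E_v` of the lattice `L = ℤ⟨E_v⟩`. -/
def E {V : Type*} (v : V) : V → ℚ := Pi.single v 1

def IsNegDef {V : Type*} [Fintype V] (Γ : PlumbingGraph V) : Prop :=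
  ∀ x : V → ℚ, x ≠ 0 → Γ.form x x < 0

/-- `x` lies in the lattice `L` (it has integral coefficients). -/
def IsIntegral {V : Type*} (x : V → ℚ) : Prop := ∃ l : V → ℤ, x = fun v => (l v : ℚ)

/-- `x` lies in the dual lattice `L' = {x ∈ L ⊗ ℚ : (x, L) ⊆ ℤ}`. -/
def InDualLattice {V : Type*} [Fintype V] (Γ : PlumbingGraph V) (x : V → ℚ) : Prop :=
  ∀ v, ∃ n : ℤ, Γ.form x (E v) = n

/-- The monoid `S'` of anti-nef cycles in `L'`. -/
def lipmanMonoid {V : Type*} [Fintype V] (Γ : PlumbingGraph V) : Set (V → ℚ) :=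
  {x | Γ.InDualLattice x ∧ ∀ v, Γ.form x (E v) ≤ 0}

/-- The part `S'_{[h]}` of `S'` in the class of `h` in `L' / L`. -/
def lipmanClass {V : Type*} [Fintype V] (Γ : PlumbingGraph V) (h : V → ℚ) : Set (V → ℚ) :=
  {x | x ∈ Γ.lipmanMonoid ∧ IsIntegral (x - h)}

open Classical in
/-- The least element of a set of cycles for the coefficientwise order
(with value `0` if there is none). -/
def leastCycle {V : Type*} (A : Set (V → ℚ)) : V → ℚ :=
  if h : ∃ a, IsLeast A a then h.choose else 0

/-- The minimal cycle `s_{[h]} = min S'_{[h]}`. -/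
def minimalRepresentative {V : Type*} [Fintype V] (Γ : PlumbingGraph V) (h : V → ℚ) : V → ℚ :=
  leastCycle (Γ.lipmanClass h)

/-- Artin's minimal (fundamental) cycle `Z_min`: the least nonzero anti-nef cycle in `L`. -/
def minimalCycle {V : Type*} [Fintype V] (Γ : PlumbingGraph V) : V → ℚ :=
  leastCycle (Γ.lipmanClass 0 \ {0})

open Classical in
/-- The anti-canonical cycle `Z_K`, the solution of the adjunction
formulae `(Z_K, E_v) = e_v + 2`. -/
def antiCanonicalCycle {V : Type*} [Fintype V] (Γ : PlumbingGraph V) : V → ℚ :=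
  Γ.intersectionMatrix⁻¹ *ᵥ fun v => (Γ.euler v : ℚ) + 2

/-- The Riemann-Roch function `χ(x) = -(x, x - Z_K) / 2`. -/
def chi {V : Type*} [Fintype V] (Γ : PlumbingGraph V) (x : V → ℚ) : ℚ :=
  -Γ.form x (x - Γ.antiCanonicalCycle) / 2

/-- Connected negative definite plumbing graph of a rational homology sphere:
a tree with negative definite intersection form. -/
structure IsResolutionGraph {V : Type*} [Fintype V] (Γ : PlumbingGraph V) : Prop where
  isTree : Γ.graph.IsTree
  isNegDef : Γ.IsNegDef

/-- Elliptic graph: the graph of a minimal resolution that is also good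
(so every Euler number is at most `-2`), with `min_{l ∈ L, l > 0} χ(l) = 0`. -/
structure IsElliptic {V : Type*} [Fintype V] (Γ : PlumbingGraph V) : Prop
    extends Γ.IsResolutionGraph where
  isMinimal : ∀ v, Γ.euler v ≤ -2
  chi_nonneg : ∀ l : V → ℤ, 0 < l → 0 ≤ Γ.chi fun v => (l v : ℚ)
  exists_chi_eq_zero : ∃ l : V → ℤ, 0 < l ∧ Γ.chi (fun v => (l v : ℚ)) = 0

open Classical in
/-- The valency `δ_v`. -/
def valency {V : Type*} [Fintype V] (Γ : PlumbingGraph V) (v : V) : ℕ := Γ.graph.degree v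

/-! ### The topological Poincaré series and the canonical polynomial -/

/-- The Taylor expansion at the origin of `∏_v (1 - T_v) ^ (δ_v - 2)`, where the variable `T_v`
stands for `t ^ (E_v^*)`; here `(E_v^*)` is the basis of `L'` with `(E_v^*, E_w) = -δ_{vw}`. -/
def poincareSeries {V : Type*} [Fintype V] (Γ : PlumbingGraph V) : MvPowerSeries V ℤ :=
  ∏ v, (1 - MvPowerSeries.X v) ^ Γ.valency v *
    (MvPowerSeries.invOfUnit (1 - MvPowerSeries.X v) 1) ^ 2

open Classical in
/-- The coefficient `z(x)` of `t ^ x` in the topological Poincaré series. The monomials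
`∏_v T_v ^ (n_v)` are the `t ^ x` with `x = ∑_v n_v E_v^*`, that is,
with `x ∈ S'` and `n_v = -(x, E_v)`. -/
def poincareCoeff {V : Type*} [Fintype V] (Γ : PlumbingGraph V) (x : V → ℚ) : ℤ :=
  if x ∈ Γ.lipmanMonoid then
    MvPowerSeries.coeff (Finsupp.equivFunOnFinite.symm fun v => ⌊-Γ.form x (E v)⌋₊)
      Γ.poincareSeries
  else 0

open Classical in
/-- The coefficients of the canonical polynomial: the coefficient `w(l)` of `t ^ l` in
`t ^ (Z_K - E) * Z_{[Z_K]}(t⁻¹)`, where `E = ∑ E_v`, provided that not all coefficients of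
`l ∈ L` are negative. -/
def canonicalCoeff {V : Type*} [Fintype V] (Γ : PlumbingGraph V) (l : V → ℤ) : ℤ :=
  if ∀ v, l v < 0 then 0
  else Γ.poincareCoeff fun v => Γ.antiCanonicalCycle v - 1 - (l v : ℚ)

theorem form_E {V : Type*} [Fintype V] (Γ : PlumbingGraph V) (x : V → ℚ) (v : V) :
    Γ.form x (E v) = ∑ w, x w * Γ.intersectionMatrix w v := by
  classical
  simp only [form, E, dotProduct, mulVec]
  refine Finset.sum_congr rfl fun w _ => ?_
  congr 1
  rw [Finset.sum_eq_single v]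
  · simp
  · intro b _ hb
    simp [hb]
  · simp

theorem form_eq_sum {V : Type*} [Fintype V] (Γ : PlumbingGraph V) (x y : V → ℚ) :
    Γ.form x y = ∑ v, y v * Γ.form x (E v) := by
  simp only [form_E, Finset.mul_sum]
  simp only [form, dotProduct, mulVec, Finset.mul_sum]
  rw [Finset.sum_comm]
  exact Finset.sum_congr rfl fun v _ => Finset.sum_congr rfl fun w _ => by ring

/-- Anti-nef cycles are effective. -/
theorem nonneg_of_antinef {V : Type*} [Fintype V] {Γ : PlumbingGraph V} (hΓ : Γ.IsNegDef)
    {x : V → ℚ} (hx : ∀ v, Γ.form x (E v) ≤ 0) (v : V) : 0 ≤ x v := by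
  by_contra! hv
  set y : V → ℚ := fun v => max (-x v) 0 with hy
  have hy0 : ∀ v, 0 ≤ y v := fun v => le_max_right _ _
  have hyne : y ≠ 0 := fun h => by
    have := congrFun h v
    have h2 : y v = -x v := max_eq_left (by linarith)
    simp only [Pi.zero_apply] at this
    linarith
  have h1 : Γ.form x y ≤ 0 := by
    rw [form_eq_sum]
    exact Finset.sum_nonpos fun v _ => mul_nonpos_of_nonneg_of_nonpos (hy0 v) (hx v)
  have h2 : -Γ.form y y ≤ Γ.form x y := by
    simp only [form_eq_sum Γ _ y, form_E, Finset.mul_sum]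
    simp only [← Finset.sum_neg_distrib]
    refine Finset.sum_le_sum fun v _ => Finset.sum_le_sum fun w _ => ?_
    by_cases hvw : w = v
    · subst hvw
      rcases le_total (x w) 0 with h | h
      · have : y w = -x w := max_eq_left (by linarith)
        rw [this]; apply le_of_eq; ring
      · have : y w = 0 := max_eq_right (by linarith)
        simp [this]
    · have hA : 0 ≤ Γ.intersectionMatrix w v := by
        simp only [intersectionMatrix, Matrix.of_apply, if_neg hvw]
        split_ifs <;> norm_num
      have hxy : -y w ≤ x w := by
        have : -x w ≤ y w := le_max_left _ _
        linarith
      have := mul_le_mul_of_nonneg_left (mul_le_mul_of_nonneg_right hxy hA) (hy0 v)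
      linarith
  linarith [hΓ y hyne]

/-- The coefficients of an anti-nef cycle bound each other. -/
theorem exists_bound_of_reachable {V : Type*} [Fintype V] {Γ : PlumbingGraph V}
    (hΓ : Γ.IsNegDef) {v w : V} (p : Γ.graph.Walk v w) :
    ∃ c : ℚ, 0 ≤ c ∧ ∀ x : V → ℚ, (∀ u, Γ.form x (E u) ≤ 0) → x w ≤ c * x v := by
  classical
  induction p with
  | nil => exact ⟨1, zero_le_one, fun x _ => by simp⟩
  | @cons a b d hab _ ih =>
    obtain ⟨c, hc, h⟩ := ih
    refine ⟨c * |(Γ.euler a : ℚ)|, mul_nonneg hc (abs_nonneg _), fun x hx => ?_⟩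
    refine (h x hx).trans ?_
    rw [mul_assoc]
    refine mul_le_mul_of_nonneg_left ?_ hc
    have h0 := nonneg_of_antinef hΓ hx
    have h1 := hx a
    rw [form_E] at h1
    have hba : b ≠ a := hab.ne'
    rw [← Finset.add_sum_erase _ _ (Finset.mem_univ a),
      ← Finset.add_sum_erase _ _ (Finset.mem_erase.2 ⟨hba, Finset.mem_univ b⟩)] at h1
    have h2 : 0 ≤ ∑ u ∈ (Finset.univ.erase a).erase b, x u * Γ.intersectionMatrix u a := by
      refine Finset.sum_nonneg fun u hu => mul_nonneg (h0 u) ?_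
      have hua : u ≠ a := (Finset.mem_erase.1 (Finset.mem_erase.1 hu).2).1
      simp only [intersectionMatrix, Matrix.of_apply, if_neg hua]
      split_ifs <;> norm_num
    have h3 : Γ.intersectionMatrix a a = Γ.euler a := by simp [intersectionMatrix]
    have h4 : Γ.intersectionMatrix b a = 1 := by
      simp [intersectionMatrix, hba, hab.symm]
    rw [h3, h4] at h1
    have h5 := mul_le_mul_of_nonneg_right (neg_abs_le (Γ.euler a : ℚ)) (h0 a)
    linarith

theorem canonicalCoeff_finite {V : Type*} [Fintype V] {Γ : PlumbingGraph V}
    (hΓ : Γ.IsResolutionGraph) : (Function.support Γ.canonicalCoeff).Finite := by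
  classical
  have hb : ∀ v w : V, ∃ c : ℚ, 0 ≤ c ∧
      ∀ x : V → ℚ, (∀ u, Γ.form x (E u) ≤ 0) → x w ≤ c * x v := fun v w => by
    obtain ⟨p⟩ := hΓ.isTree.connected.preconnected v w
    exact exists_bound_of_reachable hΓ.isNegDef p
  choose c hc hcb using hb
  set K := Γ.antiCanonicalCycle with hK
  have key : ∀ v : V, (Set.Icc (fun w => ⌊K w - 1 - c v w * (K v - 1)⌋)
      (fun w => ⌈K w - 1⌉) : Set (V → ℤ)).Finite := fun v => Set.finite_Icc _ _
  refine (Set.finite_iUnion key).subset fun l hl => ?_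
  rw [Function.mem_support] at hl
  unfold canonicalCoeff at hl
  split_ifs at hl with hneg
  · exact absurd rfl hl
  unfold poincareCoeff at hl
  split_ifs at hl with hmem
  · push Not at hneg
    obtain ⟨v, hv⟩ := hneg
    refine Set.mem_iUnion.2 ⟨v, fun w => ?_, fun w => ?_⟩
    · have h1 := hcb v w _ hmem.2
      have h2 : c v w * (K v - 1 - (l v : ℚ)) ≤ c v w * (K v - 1) := by
        refine mul_le_mul_of_nonneg_left ?_ (hc v w)
        have : (0 : ℚ) ≤ l v := by exact_mod_cast hv
        linarith
      have h3 : K w - 1 - c v w * (K v - 1) ≤ l w := by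
        simp only [← hK] at h1
        linarith
      exact_mod_cast (Int.floor_le _).trans h3
    · have h1 := nonneg_of_antinef hΓ.isNegDef hmem.2 w
      have h3 : (l w : ℚ) ≤ K w - 1 := by
        simp only [← hK] at h1
        linarith
      exact_mod_cast h3.trans (Int.le_ceil _)
  · exact absurd rfl hl

/-- The canonical polynomial `P_0`, a Laurent polynomial with exponents in `L = ℤ^V`. -/
def canonicalPolynomial {V : Type*} [Fintype V] (Γ : PlumbingGraph V)
    (hΓ : Γ.IsResolutionGraph) : AddMonoidAlgebra ℤ (V → ℤ) :=
  AddMonoidAlgebra.ofCoeff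
    (Finsupp.ofSupportFinite Γ.canonicalCoeff (canonicalCoeff_finite hΓ))

/-! ### The NN-elliptic sequence -/

open Classical in
/-- The support `|x|` of a cycle. -/
def supp {V : Type*} [Fintype V] (x : V → ℚ) : Finset V := Finset.univ.filter fun v => x v ≠ 0

open Classical in
/-- A cycle on a full subgraph, seen as a cycle on the whole graph. -/
def extendByZero {V : Type*} (S : Finset V) (x : S → ℚ) : V → ℚ :=
  fun v => if h : v ∈ S then x ⟨v, h⟩ else 0

/-- The cycles `Z_K - s_{[Z_K]} - Z_{B_0} - ⋯ - Z_{B_{k-1}}`, where `B_j` is the support of the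
`j`-th of these cycles and `Z_{B_j}` is the minimal cycle of the full subgraph `B_j`. -/
def ellipticRemainder {V : Type*} [Fintype V] (Γ : PlumbingGraph V) : ℕ → V → ℚ
  | 0 => Γ.antiCanonicalCycle - Γ.minimalRepresentative Γ.antiCanonicalCycle
  | k + 1 => Γ.ellipticRemainder k -
      extendByZero (supp (Γ.ellipticRemainder k))
        (Γ.fullSubgraph (supp (Γ.ellipticRemainder k))).minimalCycle

/-- The members `B_0 ⊋ B_1 ⊋ ⋯ ⊋ B_m` of the NN-elliptic sequence of `Γ`, as sets of vertices;
the sequence stops when the remaining cycle is zero, so that `B_k = ∅` exactly for `k > m`.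
(The remaining member `B_{-1}` is `Γ` itself.) -/
def ellipticSequence {V : Type*} [Fintype V] (Γ : PlumbingGraph V) (k : ℕ) : Finset V :=
  supp (Γ.ellipticRemainder k)

/-! ### Extensions -/

/-- `i` is the index of the extension `Γ' ⊆ Γ`, where `Γ'` is the full subgraph on `S`:
the NN-elliptic sequence of `Γ'` is `Γ', B_i, B_{i+1}, …, B_m`,
where `B_0, …, B_m` belong to the sequence of `Γ` and `0 ≤ i ≤ m`. -/
def IsExtensionIndex {V : Type*} [Fintype V] (Γ : PlumbingGraph V) (S : Finset V) (i : ℕ) :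
    Prop :=
  (Γ.ellipticSequence i).Nonempty ∧
    ∀ t, ((Γ.fullSubgraph S).ellipticSequence t).map (Function.Embedding.subtype (· ∈ S)) =
      Γ.ellipticSequence (i + t)

/-- Every vertex of `Γ'` (the full subgraph on `S`) with a neighbour outside `Γ'` is an
end-vertex of `Γ'`. -/
def AttachedAtEndVertices {V : Type*} [Fintype V] (Γ : PlumbingGraph V) (S : Finset V) : Prop :=
  ∀ v : S, (∃ w, w ∉ S ∧ Γ.graph.Adj v w) → (Γ.fullSubgraph S).valency v = 1

/-- Good extension: each exponent of the canonical polynomial of `Γ'` is the restriction of some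
exponent of the canonical polynomial of `Γ`. -/
def IsGoodExtension {V : Type*} [Fintype V] (Γ : PlumbingGraph V) (S : Finset V)
    (hΓ : Γ.IsResolutionGraph) (hS : (Γ.fullSubgraph S).IsResolutionGraph) : Prop :=
  ∀ l' ∈ ((Γ.fullSubgraph S).canonicalPolynomial hS).coeff.support,
    ∃ l ∈ (Γ.canonicalPolynomial hΓ).coeff.support, ∀ v : S, l v = l' v

open Classical in
/-- The truncation `F_i P_0`: the sum of the monomials of `P_0` all of whose exponents
at the vertices outside `B_i` are negative. -/
def truncatedPolynomial {V : Type*} [Fintype V] (Γ : PlumbingGraph V)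
    (hΓ : Γ.IsResolutionGraph) (i : ℕ) : AddMonoidAlgebra ℤ (V → ℤ) :=
  AddMonoidAlgebra.ofCoeff
    ((Γ.canonicalPolynomial hΓ).coeff.filter fun l => ∀ v, v ∉ Γ.ellipticSequence i → l v < 0)

/-- The reduction `P(t_S)`: set `t_v = 1` for all `v ∉ S`, that is, replace each
monomial `t ^ l` by `t ^ (l|_S)`. -/
def reducedPolynomial {V : Type*} (S : Finset V) (P : AddMonoidAlgebra ℤ (V → ℤ)) :
    AddMonoidAlgebra ℤ (S → ℤ) :=
  AddMonoidAlgebra.mapDomain (fun l (v : S) => l v) P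

end PlumbingGraph

end

noncomputable section

open Matrix
open scoped Classical

namespace PlumbingGraph

section

variable {V : Type*}

/-! ### Linked vertex sets -/

/-! Write an exponent as `l = -r - E`, so that its coefficient is that of `t ^ (Z_K + r)` in the
Poincaré series. This is a product over the vertices of coefficients of `(1 - T) ^ (δ_v - 2)`, taken
at the defects `-(Z_K + r, E_v)`.

The elliptic sequence has an intrinsic description. Call an effective integral cycle canonical if it
satisfies adjunction on its support. Because `χ ≥ 0`, the canonical cycles form a chain, and its
members are exactly the remainders `x_k` (`IsElliptic.exists_isCanonicalChain`,
`IsCanonicalChain.exists_eq`). The canonical cycles of `Γ'` are those of `Γ` supported on `Γ'`,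
hence a tail of this chain, and the place where the tail starts is the index
(`IsCanonicalChain.exists_tail`). The negative part of any `r` of nonzero weight is canonical too,
so it has a position in the chain.

A coefficient of the reduced truncation is a sum of weights over the `r` which extend a given cycle
from `Γ'` and are nonnegative outside `B_i`. The outer vertices are eliminated one by one
(`IsElliptic.sum_weight_eq_prod`). When only an end-vertex `t` attached at `u` is left, its factor
is the indicator that its defect is nonnegative. By ellipticity this says that its multiplicity is
at least that of the minimal extension (`IsElliptic.defect_minExtension_insert`). Summing over this
multiplicity telescopes the factor at `u` to the one for the valency without `t`. What remains is a
product over `Γ'` with the valencies of `Γ'`, but with the defects of the minimal extension instead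
of the extension by zero.

This product and the weight in `Γ'` differ at most at attached vertices. These are end-vertices of
`Γ'`, where a factor sees only the sign of the defect, so the two agree once the minimal extension
has nonnegative defects on `Γ'`. In a good extension an exponent of `Γ'` lifts to some `r`;
comparing positions in the chain shows that `r` is effective off `Γ'`, hence above the minimal
extension, which forces these signs. Conversely, a nonzero coefficient of the reduction must come
from a monomial above it. -/

/-- The vertex set `A` spans a connected subgraph. -/
def IsLinked (G : SimpleGraph V) (A : Finset V) : Prop :=
  ∀ C ⊆ A, C.Nonempty → (∀ v ∈ C, ∀ w ∈ A, G.Adj v w → w ∈ C) → C = A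

theorem isLinked_univ [Fintype V] {G : SimpleGraph V} (hG : G.Preconnected) :
    IsLinked G Finset.univ := by
  rintro C - ⟨a, ha⟩ hC
  refine Finset.eq_univ_iff_forall.2 fun b => ?_
  obtain ⟨p⟩ := hG a b
  induction p with
  | nil => exact ha
  | cons h _ ih => exact ih (hC _ ha _ (Finset.mem_univ _) h)

theorem IsLinked.exists_adj {G : SimpleGraph V} {A C : Finset V} (hA : IsLinked G A)
    (hCA : C ⊆ A) (hC : C.Nonempty) (hne : C ≠ A) : ∃ v ∈ C, ∃ w ∈ A, w ∉ C ∧ G.Adj v w := by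
  by_contra! h
  refine hne (hA C hCA hC fun v hv w hw hvw => ?_)
  by_contra hwC
  exact h v hv w hw hwC hvw

theorem IsLinked.insert {G : SimpleGraph V} {A : Finset V} (hA : IsLinked G A) {u t : V}
    (hu : u ∈ A) (hut : G.Adj u t) : IsLinked G (insert t A) := by
  intro C hC hne hcl
  have hinter : (C ∩ A).Nonempty := by
    obtain ⟨c, hc⟩ := hne
    rcases Finset.mem_insert.1 (hC hc) with rfl | h
    · exact ⟨u, Finset.mem_inter.2 ⟨hcl c hc u (Finset.mem_insert_of_mem hu) hut.symm, hu⟩⟩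
    · exact ⟨c, Finset.mem_inter.2 ⟨hc, h⟩⟩
  have h := hA (C ∩ A) Finset.inter_subset_right hinter fun v hv w hw hvw =>
    Finset.mem_inter.2 ⟨hcl v (Finset.mem_inter.1 hv).1 w (Finset.mem_insert_of_mem hw) hvw, hw⟩
  have hAC : A ⊆ C := Finset.inter_eq_right.1 h
  exact Finset.Subset.antisymm hC
    (Finset.insert_subset (hcl u (hAC hu) t (Finset.mem_insert_self _ _) hut) hAC)

/-! ### Cycles on full subgraphs -/

/-- An integral cycle on a full subgraph, seen as a cycle on the whole graph. -/
def extendInt (S : Finset V) (y : S → ℤ) : V → ℤ := fun v => if h : v ∈ S then y ⟨v, h⟩ else 0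

theorem extendInt_coe {S : Finset V} (y : S → ℤ) (v : S) : extendInt S y v = y v := by
  simp [extendInt]

theorem extendInt_of_notMem {S : Finset V} (y : S → ℤ) {v : V} (h : v ∉ S) :
    extendInt S y v = 0 := by
  simp [extendInt, h]

theorem extendInt_restrict {S : Finset V} {x : V → ℤ} (hx : ∀ v ∉ S, x v = 0) :
    extendInt S (fun v => x v) = x := by
  ext v
  by_cases h : v ∈ S
  · simp [extendInt, h]
  · simp [extendInt, h, hx v h]

theorem isLinked_of_fullSubgraph {Γ : PlumbingGraph V} {S : Finset V}
    (h : IsLinked (Γ.fullSubgraph S).graph Finset.univ) : IsLinked Γ.graph S := by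
  intro C hCS hC hcl
  have := h (Finset.univ.filter fun v : S => (v : V) ∈ C) (Finset.subset_univ _)
    (by
      obtain ⟨c, hc⟩ := hC
      exact ⟨⟨c, hCS hc⟩, by simpa using hc⟩)
    fun v hv w _ hvw => by
      simp only [Finset.mem_filter, Finset.mem_univ, true_and] at hv ⊢
      exact hcl v hv w w.2 hvw
  refine Finset.Subset.antisymm hCS fun v hv => ?_
  have h2 := Finset.mem_univ (⟨v, hv⟩ : S)
  rw [← this] at h2
  simpa using h2

theorem intersectionMatrix_transpose (Γ : PlumbingGraph V) : Γ.intersectionMatrixᵀ = Γ.intersectionMatrix := by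
  ext v w
  simp only [intersectionMatrix, transpose_apply, of_apply, Γ.graph.adj_comm w v]
  by_cases h : v = w
  · simp [h]
  · simp [h, Ne.symm h]

variable [Fintype V]

/-! ### The intersection form on integral cycles -/

/-- The intersection number `(x, E_v)` of an integral cycle `x`. -/
def pair (Γ : PlumbingGraph V) (x : V → ℤ) (v : V) : ℤ :=
  Γ.euler v * x v + ∑ w, if Γ.graph.Adj v w then x w else 0

/-- Twice the Riemann-Roch function of an integral cycle. -/
def twoChi (Γ : PlumbingGraph V) (x : V → ℤ) : ℤ :=
  ∑ v, x v * (Γ.euler v + 2 - Γ.pair x v)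

variable {Γ : PlumbingGraph V}

theorem pair_add (x y : V → ℤ) (v : V) : Γ.pair (x + y) v = Γ.pair x v + Γ.pair y v := by
  have : ∀ w, (if Γ.graph.Adj v w then (x + y) w else 0) =
      (if Γ.graph.Adj v w then x w else 0) + if Γ.graph.Adj v w then y w else 0 := by
    intro w; split_ifs <;> simp
  simp only [pair, Finset.sum_congr rfl fun w _ => this w, Finset.sum_add_distrib]
  simp only [Pi.add_apply]
  ring

theorem pair_smul (c : ℤ) (x : V → ℤ) (v : V) :
    Γ.pair (fun w => c * x w) v = c * Γ.pair x v := by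
  have : ∀ w, (if Γ.graph.Adj v w then c * x w else 0) =
      c * (if Γ.graph.Adj v w then x w else 0) := by
    intro w; split_ifs <;> simp
  simp only [pair, this, ← Finset.mul_sum]
  ring

theorem pair_neg (x : V → ℤ) (v : V) : Γ.pair (-x) v = -Γ.pair x v := by
  have := pair_smul (Γ := Γ) (-1) x v
  have h : (fun w => -1 * x w) = -x := by ext; simp
  rw [h] at this
  linarith

theorem pair_sub (x y : V → ℤ) (v : V) : Γ.pair (x - y) v = Γ.pair x v - Γ.pair y v := by
  rw [sub_eq_add_neg, pair_add, pair_neg, sub_eq_add_neg]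

@[simp] theorem pair_zero (v : V) : Γ.pair 0 v = 0 := by
  simp [pair]

theorem pair_single_self (v : V) : Γ.pair (Pi.single v 1) v = Γ.euler v := by
  have : ∀ w, (if Γ.graph.Adj v w then (Pi.single v 1 : V → ℤ) w else 0) = 0 := by
    intro w
    split_ifs with h
    · simp [h.ne']
    · rfl
  simp [pair, this]

theorem pair_single_of_ne {v w : V} (h : v ≠ w) :
    Γ.pair (Pi.single w 1) v = if Γ.graph.Adj v w then 1 else 0 := by
  simp only [pair, Pi.single_apply, h, if_false, mul_zero, zero_add]
  rw [Finset.sum_eq_single w]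
  · simp
  · intro b _ hb; simp [hb]
  · simp

/-- If `x` and `y` agree at `v` and `x ≤ y` at the neighbours of `v`, then
`(x, E_v) ≤ (y, E_v)`. -/
theorem pair_le_pair {x y : V → ℤ} {v : V} (hv : x v = y v)
    (h : ∀ w, Γ.graph.Adj v w → x w ≤ y w) : Γ.pair x v ≤ Γ.pair y v := by
  unfold pair
  rw [hv]
  gcongr with w
  split_ifs with hw
  · exact h w hw
  · exact le_rfl

theorem pair_congr {x y : V → ℤ} {v : V} (hv : x v = y v)
    (h : ∀ w, Γ.graph.Adj v w → x w = y w) : Γ.pair x v = Γ.pair y v :=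
  le_antisymm (pair_le_pair hv fun w hw => (h w hw).le)
    (pair_le_pair hv.symm fun w hw => (h w hw).ge)

theorem pair_nonneg {x : V → ℤ} {v : V} (hv : x v = 0)
    (h : ∀ w, Γ.graph.Adj v w → 0 ≤ x w) : 0 ≤ Γ.pair x v := by
  have := pair_le_pair (Γ := Γ) (x := 0) (y := x) (v := v) hv.symm h
  simpa using this

theorem one_le_pair {x : V → ℤ} {v w : V} (hv : x v = 0) (hx : 0 ≤ x)
    (hvw : Γ.graph.Adj v w) (hw : 1 ≤ x w) : 1 ≤ Γ.pair x v := by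
  have h := pair_le_pair (Γ := Γ) (x := Pi.single w 1) (y := x) (v := v)
    (by simp [hv, hvw.ne]) fun u _ => by
      by_cases hu : u = w
      · subst hu; simpa using hw
      · simpa [hu] using hx u
  rwa [pair_single_of_ne hvw.ne, if_pos hvw] at h

theorem sum_mul_pair_comm (x y : V → ℤ) :
    ∑ v, x v * Γ.pair y v = ∑ v, y v * Γ.pair x v := by
  simp only [pair, mul_add, Finset.sum_add_distrib, Finset.mul_sum]
  congr 1
  · exact Finset.sum_congr rfl fun v _ => by ring
  · rw [Finset.sum_comm]
    refine Finset.sum_congr rfl fun v _ => Finset.sum_congr rfl fun w _ => ?_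
    simp only [Γ.graph.adj_comm w v]
    split_ifs <;> ring

theorem twoChi_add (x y : V → ℤ) :
    Γ.twoChi (x + y) = Γ.twoChi x + Γ.twoChi y - 2 * ∑ v, y v * Γ.pair x v := by
  have h := sum_mul_pair_comm (Γ := Γ) x y
  have h2 : Γ.twoChi (x + y) = Γ.twoChi x + Γ.twoChi y -
      (∑ v, x v * Γ.pair y v + ∑ v, y v * Γ.pair x v) := by
    simp only [twoChi, ← Finset.sum_add_distrib, ← Finset.sum_sub_distrib, pair_add, Pi.add_apply]
    exact Finset.sum_congr rfl fun v _ => by ring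
  rw [h2, h]; ring

/-- Since `χ(E_v) = 1`, adding `E_v` changes `χ` by `1 - (x, E_v)`. This is the step of every
computation sequence below. -/
theorem twoChi_add_single (x : V → ℤ) (v : V) :
    Γ.twoChi (x + Pi.single v 1) = Γ.twoChi x + 2 - 2 * Γ.pair x v := by
  rw [twoChi_add]
  have h1 : Γ.twoChi (Pi.single v 1) = 2 := by
    unfold twoChi
    rw [Finset.sum_eq_single v]
    · simp [pair_single_self]
    · intro b _ hb; simp [hb]
    · simp
  have h2 : ∑ w, (Pi.single v 1 : V → ℤ) w * Γ.pair x w = Γ.pair x v := by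
    rw [Finset.sum_eq_single v]
    · simp
    · intro b _ hb; simp [hb]
    · simp
  rw [h1, h2]

theorem form_E_intCast (x : V → ℤ) (v : V) :
    Γ.form (fun w => (x w : ℚ)) (E v) = Γ.pair x v := by
  rw [form_E]
  have h : ∀ w, (x w : ℚ) * Γ.intersectionMatrix w v =
      (if w = v then (Γ.euler v * x v : ℚ) else 0) +
        if Γ.graph.Adj v w then (x w : ℚ) else 0 := by
    intro w
    simp only [intersectionMatrix, Matrix.of_apply]
    by_cases hw : w = v
    · subst hw; simp [mul_comm]
    · simp [hw, Γ.graph.adj_comm w v]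
  simp only [h, Finset.sum_add_distrib, pair]
  push_cast
  simp

theorem form_intCast (x y : V → ℤ) :
    Γ.form (fun w => (x w : ℚ)) (fun w => (y w : ℚ)) = ((∑ v, y v * Γ.pair x v : ℤ) : ℚ) := by
  rw [form_eq_sum]
  push_cast
  exact Finset.sum_congr rfl fun v _ => by rw [form_E_intCast]

theorem sum_mul_pair_neg (hΓ : Γ.IsNegDef) {x : V → ℤ} (hx : x ≠ 0) :
    ∑ v, x v * Γ.pair x v < 0 := by
  have := hΓ (fun v => (x v : ℚ)) fun h => hx <| by
    ext v; simpa using congrFun h v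
  rw [form_intCast] at this
  exact_mod_cast this

/-- A cycle that is anti-nef along its negative part is effective. -/
theorem nonneg_of_pair_nonpos (hΓ : Γ.IsNegDef) {z : V → ℤ}
    (hz : ∀ v, z v < 0 → Γ.pair z v ≤ 0) : 0 ≤ z := by
  set y : V → ℤ := fun v => max (-z v) 0 with hy
  have hy0 : y = 0 := by
    by_contra hne
    have h1 := sum_mul_pair_neg hΓ hne
    -- The negative part `y` dominates `-z`, with equality on its support, so `(y, E_v) ≥ -(z, E_v)
    -- ≥ 0` there. This contradicts negative definiteness unless `y = 0`.
    have h2 : ∀ v, 0 ≤ y v * Γ.pair y v := by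
      intro v
      rcases le_or_gt 0 (z v) with h | h
      · have : y v = 0 := max_eq_right (by linarith)
        simp [this]
      · have hyv : y v = -z v := max_eq_left (by linarith)
        have h3 : Γ.pair (-z) v ≤ Γ.pair y v :=
          pair_le_pair (by simp [hyv]) fun w _ => le_max_left _ _
        rw [pair_neg] at h3
        exact mul_nonneg (le_max_right _ _) (by linarith [hz v h])
    have := Finset.sum_nonneg fun v (_ : v ∈ Finset.univ) => h2 v
    linarith
  intro v
  have : y v = 0 := congrFun hy0 v
  have h2 := le_max_left (-z v) 0
  simp only [hy] at this
  simp only [Pi.zero_apply]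
  linarith

/-! ### Rational cycles and the inverse of the form. -/

theorem isUnit_det (hΓ : Γ.IsNegDef) : IsUnit Γ.intersectionMatrix.det := by
  rw [isUnit_iff_ne_zero]
  intro h
  obtain ⟨v, hv, h0⟩ := Matrix.exists_mulVec_eq_zero_iff.2 h
  have := hΓ v hv
  rw [form, h0, dotProduct_zero] at this
  exact lt_irrefl _ this

theorem form_comm (x y : V → ℚ) : Γ.form x y = Γ.form y x := by
  rw [form, form, dotProduct_mulVec, dotProduct_comm, ← mulVec_transpose,
    intersectionMatrix_transpose]

theorem form_E_eq_mulVec (x : V → ℚ) (v : V) :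
    Γ.form x (E v) = (Γ.intersectionMatrix.mulVec x) v := by
  rw [form_comm, form, E, single_one_dotProduct]

theorem form_E_inv_mulVec (hΓ : Γ.IsNegDef) (b : V → ℚ) (v : V) :
    Γ.form (Γ.intersectionMatrix⁻¹.mulVec b) (E v) = b v := by
  rw [form_E_eq_mulVec, Matrix.mulVec_mulVec, Matrix.mul_nonsing_inv _ (isUnit_det hΓ),
    Matrix.one_mulVec]

theorem form_antiCanonicalCycle (hΓ : Γ.IsNegDef) (v : V) :
    Γ.form Γ.antiCanonicalCycle (E v) = Γ.euler v + 2 :=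
  form_E_inv_mulVec hΓ _ v

theorem form_add_E (x y : V → ℚ) (v : V) :
    Γ.form (x + y) (E v) = Γ.form x (E v) + Γ.form y (E v) := by
  simp only [form_E, ← Finset.sum_add_distrib, Pi.add_apply, add_mul]

theorem chi_intCast (hΓ : Γ.IsNegDef) (l : V → ℤ) :
    Γ.chi (fun v => (l v : ℚ)) = (Γ.twoChi l : ℚ) / 2 := by
  unfold chi
  rw [form_comm, form_eq_sum, twoChi]
  push_cast
  congr 1
  rw [← Finset.sum_neg_distrib]
  refine Finset.sum_congr rfl fun v _ => ?_
  have h : Γ.form (fun v => (l v : ℚ)) (E v) =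
      Γ.form ((fun v => (l v : ℚ)) - Γ.antiCanonicalCycle) (E v) +
        Γ.form Γ.antiCanonicalCycle (E v) := by
    rw [← form_add_E, sub_add_cancel]
  rw [form_E_intCast, form_antiCanonicalCycle hΓ] at h
  rw [h]; ring

/-- There is an effective integral cycle with negative intersection with every `E_v`. -/
theorem exists_pair_neg (hΓ : Γ.IsNegDef) :
    ∃ W : V → ℤ, 0 ≤ W ∧ ∀ v, Γ.pair W v ≤ -1 := by
  set q : V → ℚ := Γ.intersectionMatrix⁻¹.mulVec fun _ => -1 with hq
  -- Clearing denominators of the rational solution of `(q, E_v) = -1` gives an integral one with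
  -- value `-D`.
  set D : ℤ := ∏ v, ((q v).den : ℤ) with hD
  have hDpos : 0 < D := Finset.prod_pos fun v _ => by exact_mod_cast (q v).den_pos
  have h : ∀ v, ∃ n : ℤ, (n : ℚ) = D * q v := by
    intro v
    refine ⟨(∏ w ∈ Finset.univ.erase v, ((q w).den : ℤ)) * (q v).num, ?_⟩
    rw [hD, ← Finset.mul_prod_erase _ _ (Finset.mem_univ v)]
    push_cast
    have : q v * (q v).den = (q v).num := Rat.mul_den_eq_num _
    rw [← this]; ring
  choose W hW using h
  have hp : ∀ v, Γ.pair W v = -D := by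
    intro v
    have h1 := form_E_intCast (Γ := Γ) W v
    have h2 := form_E_inv_mulVec hΓ (fun _ => -1) v
    rw [← hq] at h2
    have h3 : Γ.form (fun w => (W w : ℚ)) (E v) = D * Γ.form q (E v) := by
      simp only [form_E, hW, Finset.mul_sum, mul_assoc]
    rw [h3, h2] at h1
    have : ((Γ.pair W v : ℤ) : ℚ) = ((-D : ℤ) : ℚ) := by rw [← h1]; push_cast; ring
    exact_mod_cast this
  refine ⟨W, nonneg_of_pair_nonpos hΓ fun v _ => ?_, fun v => ?_⟩ <;> rw [hp] <;> omega

/-! ### Least elements of sets of integral cycles -/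

/-- A member of minimal coefficient sum is least: its infimum with a member not above it would have
a smaller sum. -/
theorem exists_isLeast {F : Set (V → ℤ)} (hne : F.Nonempty) (b : V → ℤ)
    (hb : ∀ r ∈ F, b ≤ r) (hmin : ∀ r ∈ F, ∀ s ∈ F, r ⊓ s ∈ F) : ∃ m, IsLeast F m := by
  have h : ∃ n : ℕ, ∃ r ∈ F, ∑ v, (r v - b v) = n := by
    obtain ⟨r, hr⟩ := hne
    exact ⟨(∑ v, (r v - b v)).toNat, r, hr, (Int.toNat_of_nonneg
      (Finset.sum_nonneg fun v _ => sub_nonneg.2 (hb r hr v))).symm⟩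
  obtain ⟨m, hm, hs⟩ := Nat.find_spec h
  refine ⟨m, hm, fun r hr v => ?_⟩
  by_contra! hv
  have hmr := hmin m hm r hr
  have hnn : 0 ≤ ∑ v, ((m ⊓ r) v - b v) :=
    Finset.sum_nonneg fun v _ => sub_nonneg.2 (hb _ hmr v)
  have hlt : ∑ v, ((m ⊓ r) v - b v) < ∑ v, (m v - b v) :=
    Finset.sum_lt_sum (fun w _ => sub_le_sub_right (inf_le_left (a := m) (b := r) w) _)
      ⟨v, Finset.mem_univ v, sub_lt_sub_right (lt_of_le_of_lt (inf_le_right (a := m) (b := r) v) hv) _⟩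
  exact Nat.find_min h (m := (∑ v, ((m ⊓ r) v - b v)).toNat) (by omega)
    ⟨m ⊓ r, hmr, by omega⟩

/-- At `v` the minimum agrees with one of the cycles and lies below it at the neighbours. Hence
upper bounds on intersection numbers survive infima. -/
theorem pair_inf_le (x y : V → ℤ) (v : V) :
    (x ⊓ y) v = x v ∧ Γ.pair (x ⊓ y) v ≤ Γ.pair x v ∨
      (x ⊓ y) v = y v ∧ Γ.pair (x ⊓ y) v ≤ Γ.pair y v := by
  rcases le_total (x v) (y v) with h | h
  · have h' : (x ⊓ y) v = x v := by simp [h]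
    exact Or.inl ⟨h', pair_le_pair h' fun w _ => by simp⟩
  · have h' : (x ⊓ y) v = y v := by simp [h]
    exact Or.inr ⟨h', pair_le_pair h' fun w _ => by simp⟩

/-! ### Intersection numbers on full subgraphs. -/

theorem sum_eq_sum_coe {S : Finset V} {f : V → ℤ} (hf : ∀ v ∉ S, f v = 0) :
    ∑ v, f v = ∑ v : S, f v := by
  rw [Finset.sum_coe_sort S f]
  exact (Finset.sum_subset (Finset.subset_univ S) fun v _ h => hf v h).symm

theorem pair_fullSubgraph {S : Finset V} (y : S → ℤ) (v : S) :
    (Γ.fullSubgraph S).pair y v = Γ.pair (extendInt S y) v := by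
  unfold pair
  rw [extendInt_coe, sum_eq_sum_coe (S := S)]
  · simp only [extendInt_coe]
    rfl
  · intro w hw
    simp [extendInt_of_notMem y hw]

theorem twoChi_fullSubgraph {S : Finset V} (y : S → ℤ) :
    (Γ.fullSubgraph S).twoChi y = Γ.twoChi (extendInt S y) := by
  unfold twoChi
  rw [sum_eq_sum_coe (S := S)]
  · simp only [extendInt_coe, pair_fullSubgraph]
    rfl
  · intro w hw
    simp [extendInt_of_notMem y hw]

end

section

variable {V : Type*} [Fintype V] {Γ : PlumbingGraph V}

/-! ### Canonical cycles -/

theorem IsElliptic.twoChi_nonneg (hΓ : Γ.IsElliptic) {l : V → ℤ} (hl : 0 ≤ l) :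
    0 ≤ Γ.twoChi l := by
  rcases hl.eq_or_lt with rfl | h
  · simp [twoChi]
  · have := hΓ.chi_nonneg l h
    rw [chi_intCast hΓ.isNegDef] at this
    have h2 : (0 : ℚ) ≤ Γ.twoChi l := by linarith
    exact_mod_cast h2

theorem IsElliptic.exists_twoChi_eq_zero (hΓ : Γ.IsElliptic) :
    ∃ l : V → ℤ, 0 < l ∧ Γ.twoChi l = 0 := by
  obtain ⟨l, hl, h⟩ := hΓ.exists_chi_eq_zero
  rw [chi_intCast hΓ.isNegDef] at h
  have h2 : (Γ.twoChi l : ℚ) = 0 := by linarith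
  exact ⟨l, hl, by exact_mod_cast h2⟩

theorem IsElliptic.isLinked_univ (hΓ : Γ.IsElliptic) : IsLinked Γ.graph Finset.univ :=
  PlumbingGraph.isLinked_univ hΓ.isTree.connected.preconnected

/-- An effective integral cycle which satisfies the adjunction formulae on its support, so that
it is the anti-canonical cycle of its support. -/
def IsCanonical (Γ : PlumbingGraph V) (x : V → ℤ) : Prop :=
  0 ≤ x ∧ ∀ v, x v ≠ 0 → Γ.pair x v = Γ.euler v + 2

theorem isCanonical_zero : Γ.IsCanonical 0 := ⟨le_rfl, fun _ hv => absurd rfl hv⟩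

theorem IsCanonical.twoChi_eq_zero {x : V → ℤ} (hx : Γ.IsCanonical x) : Γ.twoChi x = 0 := by
  refine Finset.sum_eq_zero fun v _ => ?_
  by_cases hv : x v = 0
  · simp [hv]
  · rw [hx.2 v hv]; ring

/-- The hypothesis makes every summand of `2χ(x) = ∑ x_v (e_v + 2 - (x, E_v))` nonpositive, while
`χ(x) ≥ 0`. So all summands vanish. -/
theorem IsElliptic.isCanonical_of_le (hΓ : Γ.IsElliptic) {x : V → ℤ} (hx : 0 ≤ x)
    (h : ∀ v, x v ≠ 0 → Γ.euler v + 2 ≤ Γ.pair x v) : Γ.IsCanonical x := by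
  have hterm : ∀ v ∈ Finset.univ, x v * (Γ.euler v + 2 - Γ.pair x v) ≤ 0 := by
    intro v _
    by_cases hv : x v = 0
    · simp [hv]
    · exact mul_nonpos_of_nonneg_of_nonpos (hx v) (by linarith [h v hv])
  have h0 : Γ.twoChi x = 0 := le_antisymm (Finset.sum_nonpos hterm) (hΓ.twoChi_nonneg hx)
  refine ⟨hx, fun v hv => ?_⟩
  have := (Finset.sum_eq_zero_iff_of_nonpos hterm).1 h0 v (Finset.mem_univ v)
  rcases mul_eq_zero.1 this with h1 | h1
  · exact absurd h1 hv
  · linarith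

/-- Take a nonzero effective `l` with `χ(l) = 0` and minimal coefficient sum. Removing `E_v` makes
`χ` positive, so `(l - E_v, E_v) ≥ 2`, which is the adjunction inequality. -/
theorem IsElliptic.exists_isCanonical_ne_zero (hΓ : Γ.IsElliptic) :
    ∃ x, Γ.IsCanonical x ∧ x ≠ 0 := by
  have hex : ∃ n : ℕ, ∃ l : V → ℤ, 0 < l ∧ Γ.twoChi l = 0 ∧ ∑ v, l v = n := by
    obtain ⟨l, hl, h⟩ := hΓ.exists_twoChi_eq_zero
    exact ⟨(∑ v, l v).toNat, l, hl, h,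
      (Int.toNat_of_nonneg (Finset.sum_nonneg fun v _ => hl.le v)).symm⟩
  obtain ⟨l, hl, hchi, hsum⟩ := Nat.find_spec hex
  refine ⟨l, hΓ.isCanonical_of_le hl.le fun v hv => ?_, hl.ne'⟩
  set y : V → ℤ := l - Pi.single v 1 with hy
  have hly : l = y + Pi.single v 1 := by rw [hy]; abel
  have hpos : 1 ≤ l v := lt_of_le_of_ne (hl.le v) (Ne.symm hv)
  have hy0 : 0 ≤ y := by
    intro w
    by_cases hw : w = v
    · subst hw; simpa [hy] using hpos
    · simpa [hy, hw] using hl.le w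
  have hstep := twoChi_add_single (Γ := Γ) y v
  rw [← hly, hchi] at hstep
  have hpy : Γ.pair y v = Γ.pair l v - Γ.euler v := by
    rw [hy, pair_sub, pair_single_self]
  rcases hy0.eq_or_lt with h0 | hlt
  · rw [← h0] at hstep
    simp [twoChi] at hstep
  · have hne : Γ.twoChi y ≠ 0 := by
      intro h
      have hs : ∑ w, y w = ∑ w, l w - 1 := by
        simp [hy, Finset.sum_sub_distrib]
      have hn : 0 ≤ ∑ w, y w := Finset.sum_nonneg fun w _ => hy0 w
      exact Nat.find_min hex (m := (∑ w, y w).toNat) (by omega) ⟨y, hlt, h, by omega⟩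
    have := hΓ.twoChi_nonneg hy0
    omega

/-- The support of an integral cycle. -/
def intSupp (x : V → ℤ) : Finset V := Finset.univ.filter fun v => x v ≠ 0

@[simp] theorem mem_intSupp {x : V → ℤ} {v : V} : v ∈ intSupp x ↔ x v ≠ 0 := by
  simp [intSupp]

theorem intSupp_nonempty {x : V → ℤ} : (intSupp x).Nonempty ↔ x ≠ 0 := by
  rw [Function.ne_iff]
  exact exists_congr fun v => mem_intSupp

theorem supp_intCast (x : V → ℤ) : supp (fun v => (x v : ℚ)) = intSupp x := by
  ext v; simp [supp]

/-- Adding to a cycle with `χ = 0` a vertex adjacent to its support preserves `χ = 0`. -/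
theorem IsElliptic.twoChi_add_single_eq_zero (hΓ : Γ.IsElliptic) {l : V → ℤ} (hl : 0 ≤ l)
    (h0 : Γ.twoChi l = 0) {v : V} (hv : 1 ≤ Γ.pair l v) :
    Γ.twoChi (l + Pi.single v 1) = 0 := by
  have h1 := twoChi_add_single (Γ := Γ) l v
  have h2 := hΓ.twoChi_nonneg (l := l + Pi.single v 1)
    (add_nonneg hl (Pi.single_nonneg.2 zero_le_one))
  omega

/-- Nonzero effective cycles with `χ = 0` on an elliptic graph have intersecting supports. -/
theorem IsElliptic.not_disjoint_intSupp (hΓ : Γ.IsElliptic) {x y : V → ℤ} (hx : 0 ≤ x)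
    (hy : 0 ≤ y) (hx0 : x ≠ 0) (hy0 : y ≠ 0) (hxχ : Γ.twoChi x = 0) (hyχ : Γ.twoChi y = 0) :
    ¬ Disjoint (intSupp x) (intSupp y) := by
  induction hn : (Fintype.card V - (intSupp x).card) using Nat.strong_induction_on
    generalizing x with
  | _ n ih =>
  intro hd
  obtain ⟨b, hb⟩ := intSupp_nonempty.2 hy0
  have hne : intSupp x ≠ Finset.univ := fun h =>
    Finset.disjoint_left.1 hd (h ▸ Finset.mem_univ b) hb
  obtain ⟨v, hv, w, -, hw, hvw⟩ := hΓ.isLinked_univ.exists_adj (Finset.subset_univ _)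
    (intSupp_nonempty.2 hx0) hne
  have hxw : x w = 0 := by simpa using hw
  have hp : 1 ≤ Γ.pair x w := by
    refine one_le_pair hxw hx hvw.symm ?_
    have := hx v
    rw [mem_intSupp] at hv
    simp only [Pi.zero_apply] at this
    omega
  -- The support of `x` grows by adjacent vertices, keeping `χ(x) = 0`, until it touches that of
  -- `y`. Then `(x, y) > 0` gives `χ(x + y) < 0`.
  by_cases hwy : w ∈ intSupp y
  · have hχ := hΓ.twoChi_nonneg (add_nonneg hx hy)
    rw [twoChi_add, hxχ, hyχ] at hχ
    have hterm : ∀ u ∈ Finset.univ, 0 ≤ y u * Γ.pair x u := by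
      intro u _
      by_cases hu : y u = 0
      · simp [hu]
      · refine mul_nonneg (hy u) (pair_nonneg ?_ fun w _ => hx w)
        by_contra hxu
        exact Finset.disjoint_left.1 hd (mem_intSupp.2 hxu) (mem_intSupp.2 hu)
    have h1 := Finset.single_le_sum hterm (Finset.mem_univ w)
    have h2 : 0 < y w * Γ.pair x w := by
      refine mul_pos (lt_of_le_of_ne (hy w) (Ne.symm (mem_intSupp.1 hwy))) (by omega)
    omega
  · have hx' : 0 ≤ x + Pi.single w 1 := add_nonneg hx (Pi.single_nonneg.2 zero_le_one)
    have hs : intSupp (x + Pi.single w 1) = insert w (intSupp x) := by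
      ext u
      by_cases hu : u = w
      · subst hu; simp [hxw]
      · simp [hu]
    have hcard : (insert w (intSupp x)).card ≤ Fintype.card V := Finset.card_le_univ _
    rw [Finset.card_insert_of_notMem hw] at hcard
    refine ih _ ?_ hx' ?_ (hΓ.twoChi_add_single_eq_zero hx hxχ hp) rfl ?_
    · rw [hs, Finset.card_insert_of_notMem hw]; omega
    · rw [← intSupp_nonempty, hs]; exact Finset.insert_nonempty _ _
    · rw [hs]; exact Finset.disjoint_insert_left.2 ⟨hwy, hd⟩

/-- Restricting to a union of components of the support preserves adjunction, so a disconnected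
support would yield two disjoint canonical cycles. -/
theorem IsElliptic.isLinked_intSupp (hΓ : Γ.IsElliptic) {x : V → ℤ} (hx : Γ.IsCanonical x) :
    IsLinked Γ.graph (intSupp x) := by
  intro C hC hne hcl
  by_contra hCx
  have hcan : ∀ D : Finset V, (∀ v ∈ D, ∀ w, Γ.graph.Adj v w → x w ≠ 0 → w ∈ D) →
      Γ.IsCanonical fun v => if v ∈ D then x v else 0 := by
    refine fun D hD => ⟨fun v => ?_, fun v hv => ?_⟩
    · dsimp only
      split_ifs
      · exact hx.1 v
      · exact le_rfl
    · have hvD : v ∈ D := by by_contra h; simp [h] at hv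
      have hxv : x v ≠ 0 := by simpa [hvD] using hv
      rw [← hx.2 v hxv]
      refine pair_congr (by simp [hvD]) fun w hw => ?_
      by_cases hwD : w ∈ D
      · simp [hwD]
      · by_cases hxw : x w = 0
        · simp [hxw]
        · exact absurd (hD v hvD w hw hxw) hwD
  have h1 := hcan C fun v hv w hw hxw => hcl v hv w (mem_intSupp.2 hxw) hw
  have h2 := hcan (intSupp x \ C) fun v hv w hw hxw => by
    rw [Finset.mem_sdiff] at hv ⊢
    exact ⟨mem_intSupp.2 hxw, fun hwC => hv.2 (hcl w hwC v hv.1 hw.symm)⟩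
  refine hΓ.not_disjoint_intSupp h1.1 h2.1 ?_ ?_ h1.twoChi_eq_zero h2.twoChi_eq_zero ?_
  · obtain ⟨c, hc⟩ := hne
    intro h
    have := congrFun h c
    simp only [hc, if_true, Pi.zero_apply] at this
    exact mem_intSupp.1 (hC hc) this
  · have hssub : C ⊂ intSupp x := lt_of_le_of_ne hC hCx
    obtain ⟨c, hc, hcC⟩ := Finset.exists_of_ssubset hssub
    intro h
    have := congrFun h c
    simp only [Finset.mem_sdiff, hc, hcC, not_false_eq_true, and_self, if_true,
      Pi.zero_apply] at this
    exact mem_intSupp.1 hc this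
  · rw [Finset.disjoint_left]
    intro v hv hv2
    rw [mem_intSupp] at hv hv2
    by_cases hvC : v ∈ C
    · simp [hvC] at hv2
    · simp [hvC] at hv

/-- The difference is orthogonal to every `E_v` in the common support, hence to itself. -/
theorem IsCanonical.eq_of_intSupp_eq (hΓ : Γ.IsNegDef) {x y : V → ℤ} (hx : Γ.IsCanonical x)
    (hy : Γ.IsCanonical y) (h : intSupp x = intSupp y) : x = y := by
  by_contra hne
  refine (sum_mul_pair_neg hΓ (sub_ne_zero.2 hne)).ne (Finset.sum_eq_zero fun v _ => ?_)
  have hv : x v ≠ 0 ↔ y v ≠ 0 := by rw [← mem_intSupp, h, mem_intSupp]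
  by_cases hxv : x v = 0
  · have hyv : y v = 0 := by
      by_contra hyv
      exact hv.2 hyv hxv
    simp [hxv, hyv]
  · rw [pair_sub, hx.2 v hxv, hy.2 v (hv.1 hxv), sub_self, mul_zero]

/-! ### Minimal cycles of full subgraphs -/

/-- The nonzero integral cycles supported on `B` which are anti-nef on `B`. -/
def antinefOn (Γ : PlumbingGraph V) (B : Finset V) : Set (V → ℤ) :=
  {z | (∀ v ∉ B, z v = 0) ∧ z ≠ 0 ∧ ∀ v ∈ B, Γ.pair z v ≤ 0}

theorem nonneg_of_mem_antinefOn (hΓ : Γ.IsNegDef) {B : Finset V} {z : V → ℤ}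
    (hz : z ∈ Γ.antinefOn B) : 0 ≤ z :=
  nonneg_of_pair_nonpos hΓ fun v hv => hz.2.2 v <| by
    by_contra h
    rw [hz.1 v h] at hv
    exact lt_irrefl _ hv

/-- A vertex of `B` outside the support but adjacent to it would have positive intersection with
`z`. -/
theorem pos_of_mem_antinefOn (hΓ : Γ.IsNegDef) {B : Finset V} (hB : IsLinked Γ.graph B)
    {z : V → ℤ} (hz : z ∈ Γ.antinefOn B) {v : V} (hv : v ∈ B) : 0 < z v := by
  have h0 := nonneg_of_mem_antinefOn hΓ hz
  have hsupp : intSupp z = B := by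
    refine hB _ (fun v hv => ?_) (intSupp_nonempty.2 hz.2.1) fun v hv w hw hvw => ?_
    · by_contra h
      exact mem_intSupp.1 hv (hz.1 v h)
    · rw [mem_intSupp] at hv ⊢
      intro hzw
      have := one_le_pair hzw h0 hvw.symm (lt_of_le_of_ne (h0 v) (Ne.symm hv))
      linarith [hz.2.2 w hw]
  rw [← hsupp, mem_intSupp] at hv
  exact lt_of_le_of_ne (h0 v) (Ne.symm hv)

theorem exists_isLeast_antinefOn (hΓ : Γ.IsNegDef) {B : Finset V} (hB : IsLinked Γ.graph B)
    (hne : B.Nonempty) : ∃ z, IsLeast (Γ.antinefOn B) z := by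
  refine exists_isLeast ?_ 0 (fun z hz => nonneg_of_mem_antinefOn hΓ hz) fun r hr s hs => ?_
  · obtain ⟨W, hW0, hW⟩ := exists_pair_neg hΓ
    have hp : ∀ v ∈ B, Γ.pair (fun v => if v ∈ B then W v else 0) v ≤ -1 := by
      refine fun v hv => (pair_le_pair (by simp [hv]) fun w _ => ?_).trans (hW v)
      split_ifs
      · exact le_rfl
      · exact hW0 w
    refine ⟨fun v => if v ∈ B then W v else 0, fun v hv => by simp [hv], fun h => ?_,
      fun v hv => (hp v hv).trans (by norm_num)⟩
    obtain ⟨v, hv⟩ := hne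
    have := hp v hv
    rw [h, pair_zero] at this
    omega
  · refine ⟨fun v hv => by simp [hr.1 v hv, hs.1 v hv], fun h => ?_, fun v hv => ?_⟩
    · obtain ⟨v, hv⟩ := hne
      have h1 := lt_min (pos_of_mem_antinefOn hΓ hB hr hv) (pos_of_mem_antinefOn hΓ hB hs hv)
      have h2 := congrFun h v
      simp only [Pi.inf_apply, Pi.zero_apply] at h2
      exact h1.ne' h2
    · rcases pair_inf_le (Γ := Γ) r s v with h | h
      · exact h.2.trans (hr.2.2 v hv)
      · exact h.2.trans (hs.2.2 v hv)

theorem leastCycle_eq {V : Type*} {A : Set (V → ℚ)} {a : V → ℚ} (h : IsLeast A a) :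
    leastCycle A = a := by
  have hex : ∃ a, IsLeast A a := ⟨a, h⟩
  rw [leastCycle, dif_pos hex]
  exact hex.choose_spec.unique h

theorem isLeast_add_intCast {V : Type*} {A : Set (V → ℚ)} {F : Set (V → ℤ)} {c : V → ℚ}
    {m : V → ℤ} (hA : ∀ x, x ∈ A ↔ ∃ r ∈ F, x = c + fun v => (r v : ℚ)) (hm : IsLeast F m) :
    IsLeast A (c + fun v => (m v : ℚ)) := by
  refine ⟨(hA _).2 ⟨m, hm.1, rfl⟩, fun x hx => ?_⟩
  obtain ⟨r, hr, rfl⟩ := (hA x).1 hx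
  have := hm.2 hr
  intro v
  simpa using this v

theorem mem_lipmanClass_iff {h : V → ℚ} {k : V → ℤ} (hk : ∀ v, Γ.form h (E v) = k v)
    (x : V → ℚ) : x ∈ Γ.lipmanClass h ↔
      ∃ r ∈ {r : V → ℤ | ∀ v, Γ.pair r v + k v ≤ 0}, x = h + fun v => (r v : ℚ) := by
  have hform : ∀ (r : V → ℤ) v, Γ.form (h + fun v => (r v : ℚ)) (E v) =
      ((Γ.pair r v + k v : ℤ) : ℚ) := by
    intro r v
    rw [form_add_E, hk, form_E_intCast]; push_cast; ring
  constructor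
  · rintro ⟨⟨-, h2⟩, l, hl⟩
    have hx : x = h + fun v => (l v : ℚ) := by rw [← hl]; abel
    refine ⟨l, fun v => ?_, hx⟩
    have := h2 v
    rw [hx, hform] at this
    exact_mod_cast this
  · rintro ⟨r, hr, rfl⟩
    refine ⟨⟨fun v => ⟨_, hform r v⟩, fun v => ?_⟩, r, by abel⟩
    rw [hform]
    exact_mod_cast hr v

theorem extendByZero_minimalCycle {B : Finset V} {z : V → ℤ} (hz : IsLeast (Γ.antinefOn B) z) :
    extendByZero B (Γ.fullSubgraph B).minimalCycle = fun v => (z v : ℚ) := by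
  have hleast : IsLeast ({y : B → ℤ | ∀ v, (Γ.fullSubgraph B).pair y v + 0 ≤ 0} \ {0})
      fun v => z v := by
    have hext := extendInt_restrict hz.1.1
    refine ⟨⟨fun v => ?_, fun h => hz.1.2.1 ?_⟩, fun y hy v => ?_⟩
    · rw [pair_fullSubgraph, hext, add_zero]
      exact hz.1.2.2 v v.2
    · rw [← hext, h]
      ext v; simp [extendInt]
    · have : extendInt B y ∈ Γ.antinefOn B := by
        refine ⟨fun v hv => extendInt_of_notMem y hv, fun h => hy.2 ?_, fun v hv => ?_⟩
        · ext v
          rw [← extendInt_coe y v, h]; rfl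
        · have := hy.1 ⟨v, hv⟩
          rwa [pair_fullSubgraph, add_zero] at this
      have := hz.2 this v
      rwa [extendInt_coe] at this
  have hA : ∀ x, x ∈ (Γ.fullSubgraph B).lipmanClass 0 \ {0} ↔
      ∃ r ∈ {y : B → ℤ | ∀ v, (Γ.fullSubgraph B).pair y v + 0 ≤ 0} \ {0},
        x = 0 + fun v => (r v : ℚ) := by
    intro x
    have hcl := mem_lipmanClass_iff (Γ := Γ.fullSubgraph B) (h := 0) (k := 0)
      (fun v => by simp [form_E]) x
    rw [Set.mem_sdiff, hcl]
    constructor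
    · rintro ⟨⟨r, hr, rfl⟩, hne⟩
      refine ⟨r, ⟨hr, fun h => hne ?_⟩, rfl⟩
      rw [Set.mem_singleton_iff] at h ⊢
      rw [h]; ext v; simp
    · rintro ⟨r, ⟨hr, hne⟩, rfl⟩
      refine ⟨⟨r, hr, rfl⟩, fun h => hne ?_⟩
      ext v
      have := congrFun h v
      simpa using this
  rw [minimalCycle, leastCycle_eq (isLeast_add_intCast hA hleast)]
  ext v
  by_cases hv : v ∈ B
  · simp [extendByZero, hv]
  · simp [extendByZero, hv, hz.1.1 v hv]

/-! ### The elliptic sequence as a sequence of canonical cycles -/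

/-- Write `s_{[Z_K]} = Z_K + m`. Anti-nefness is the adjunction inequality for `-m`, which
ellipticity turns into equality on the support; conversely `Z_K - y` is anti-nef for each canonical
`y`, so minimality of `m` is maximality of `-m`. -/
theorem IsElliptic.ellipticRemainder_zero (hΓ : Γ.IsElliptic) :
    ∃ x : V → ℤ, IsGreatest {y | Γ.IsCanonical y} x ∧
      Γ.ellipticRemainder 0 = fun v => (x v : ℚ) := by
  set F : Set (V → ℤ) := {r | ∀ v, Γ.pair r v + (Γ.euler v + 2) ≤ 0} with hF
  have hA := mem_lipmanClass_iff (Γ := Γ) (h := Γ.antiCanonicalCycle)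
    (k := fun v => Γ.euler v + 2) fun v => by
      rw [form_antiCanonicalCycle hΓ.isNegDef]; push_cast; rfl
  obtain ⟨m, hm⟩ : ∃ m, IsLeast F m := by
    -- Zero is admissible because `e_v ≤ -2`. The lower bound expresses that the anti-nef cycle `Z_K
    -- + r` is effective.
    refine exists_isLeast ⟨0, fun v => ?_⟩ (fun v => -⌈Γ.antiCanonicalCycle v⌉) (fun r hr v => ?_)
      fun r hr s hs v => ?_
    · have := hΓ.isMinimal v
      simp only [pair_zero]; omega
    · have h1 := nonneg_of_antinef hΓ.isNegDef ((hA _).2 ⟨r, hr, rfl⟩).1.2 v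
      simp only [Pi.add_apply] at h1
      have h2 := Int.le_ceil (Γ.antiCanonicalCycle v)
      have h3 : (0 : ℚ) ≤ ((⌈Γ.antiCanonicalCycle v⌉ + r v : ℤ) : ℚ) := by
        push_cast; linarith
      have h4 : 0 ≤ ⌈Γ.antiCanonicalCycle v⌉ + r v := by exact_mod_cast h3
      exact neg_le_iff_add_nonneg'.2 h4
    · rcases pair_inf_le (Γ := Γ) r s v with h | h
      · linarith [h.2, hr v]
      · linarith [h.2, hs v]
  refine ⟨-m, ⟨?_, fun y hy => ?_⟩, ?_⟩
  · refine hΓ.isCanonical_of_le ?_ fun v _ => ?_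
    · have : m ≤ 0 := hm.2 fun v => by
        have := hΓ.isMinimal v
        simp only [pair_zero]; omega
      exact neg_nonneg.2 this
    · have := hm.1 v
      rw [pair_neg]; omega
  · have : m ≤ -y := hm.2 fun v => by
      rw [pair_neg]
      by_cases hv : y v = 0
      · have h1 := pair_nonneg (Γ := Γ) hv fun w _ => hy.1 w
        have := hΓ.isMinimal v
        omega
      · rw [hy.2 v hv]; omega
    exact le_neg.1 this
  · have h := leastCycle_eq (isLeast_add_intCast hA hm)
    rw [ellipticRemainder, minimalRepresentative, h]
    ext v; simp

/-- In `0 = χ(x) = χ(x - z) + χ(z) - (x - z, z)` all three contributions are nonnegative, so `z` is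
orthogonal to the support of `x - z`, where adjunction therefore persists. For a smaller canonical
`y`, the cycle `x - y` is anti-nef on the support of `x`, hence at least `z`. -/
theorem IsElliptic.isGreatest_sub (hΓ : Γ.IsElliptic) {x z : V → ℤ} (hx : Γ.IsCanonical x)
    (hx0 : x ≠ 0) (hz : IsLeast (Γ.antinefOn (intSupp x)) z) :
    IsGreatest {y | Γ.IsCanonical y ∧ y ≤ x ∧ y ≠ x} (x - z) := by
  have hz0 := nonneg_of_mem_antinefOn hΓ.isNegDef hz.1
  have hzx : z ≤ x := hz.2 ⟨fun v hv => by simpa using hv, hx0, fun v hv => by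
    rw [hx.2 v (mem_intSupp.1 hv)]
    linarith [hΓ.isMinimal v]⟩
  have hxz : 0 ≤ x - z := sub_nonneg.2 hzx
  have hzero : ∀ v, (x - z) v ≠ 0 → v ∈ intSupp x := by
    intro v hv
    by_contra h
    have h1 : x v = 0 := by simpa using h
    simp [h1, hz.1.1 v h] at hv
  refine ⟨⟨⟨hxz, fun v hv => ?_⟩, sub_le_self _ hz0, fun h => hz.1.2.1 ?_⟩, fun y hy => ?_⟩
  · have h1 := twoChi_add (Γ := Γ) (x - z) z
    rw [sub_add_cancel, hx.twoChi_eq_zero, sum_mul_pair_comm] at h1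
    have hterm : ∀ v ∈ Finset.univ, (x - z) v * Γ.pair z v ≤ 0 := by
      intro v _
      by_cases hv : (x - z) v = 0
      · simp [hv]
      · exact mul_nonpos_of_nonneg_of_nonpos (hxz v) (hz.1.2.2 v (hzero v hv))
    have h2 := hΓ.twoChi_nonneg hxz
    have h3 := hΓ.twoChi_nonneg hz0
    have h4 := Finset.sum_nonpos hterm
    have h5 := (Finset.sum_eq_zero_iff_of_nonpos hterm).1 (by omega) v (Finset.mem_univ v)
    rw [pair_sub, hx.2 v (mem_intSupp.1 (hzero v hv)), (mul_eq_zero.1 h5).resolve_left hv,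
      sub_zero]
  · simpa using h
  · have : z ≤ x - y := hz.2 <| by
      refine ⟨fun v hv => ?_, sub_ne_zero.2 (Ne.symm hy.2.2), fun v hv => ?_⟩
      · have h1 : x v = 0 := by simpa using hv
        have h2 := hy.1.1 v
        have h3 := hy.2.1 v
        rw [h1] at h3
        rw [Pi.sub_apply, h1, le_antisymm h3 h2, sub_zero]
      · rw [pair_sub, hx.2 v (mem_intSupp.1 hv)]
        by_cases hyv : y v = 0
        · have h1 := pair_nonneg (Γ := Γ) hyv fun w _ => hy.1.1 w
          linarith [hΓ.isMinimal v]
        · rw [hy.1.2 v hyv, sub_self]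
    exact le_sub_comm.1 this

theorem ellipticRemainder_succ {k : ℕ} {x z : V → ℤ}
    (hx : Γ.ellipticRemainder k = fun v => (x v : ℚ))
    (hz : IsLeast (Γ.antinefOn (intSupp x)) z) :
    Γ.ellipticRemainder (k + 1) = fun v => ((x - z) v : ℚ) := by
  rw [ellipticRemainder, hx, supp_intCast, extendByZero_minimalCycle hz]
  ext v; simp

theorem ellipticRemainder_succ_of_eq_zero {k : ℕ} (hx : Γ.ellipticRemainder k = 0) :
    Γ.ellipticRemainder (k + 1) = 0 := by
  rw [ellipticRemainder, hx, zero_sub, neg_eq_zero]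
  ext v
  simp [extendByZero, supp]

/-- `x` is the chain of all canonical cycles of an elliptic graph, in decreasing order. -/
structure IsCanonicalChain (Γ : PlumbingGraph V) (x : ℕ → V → ℤ) : Prop where
  isGreatest_zero : IsGreatest {y | Γ.IsCanonical y} (x 0)
  zero_ne : x 0 ≠ 0
  isGreatest_succ : ∀ k, x k ≠ 0 →
    IsGreatest {y | Γ.IsCanonical y ∧ y ≤ x k ∧ y ≠ x k} (x (k + 1))
  succ_lt : ∀ k v, x k v ≠ 0 → x (k + 1) v < x k v
  succ_eq_zero : ∀ k, x k = 0 → x (k + 1) = 0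

theorem IsElliptic.exists_isCanonicalChain (hΓ : Γ.IsElliptic) :
    ∃ x, Γ.IsCanonicalChain x ∧ ∀ k, Γ.ellipticRemainder k = fun v => (x k v : ℚ) := by
  have hleast : ∀ x, Γ.IsCanonical x → x ≠ 0 → ∃ z, IsLeast (Γ.antinefOn (intSupp x)) z :=
    fun x hx hx0 => exists_isLeast_antinefOn hΓ.isNegDef (hΓ.isLinked_intSupp hx)
      (intSupp_nonempty.2 hx0)
  have hex : ∀ k, ∃ x, Γ.IsCanonical x ∧ Γ.ellipticRemainder k = fun v => (x v : ℚ) := by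
    intro k
    induction k with
    | zero =>
      obtain ⟨x, hx, h⟩ := hΓ.ellipticRemainder_zero
      exact ⟨x, hx.1, h⟩
    | succ k ih =>
      obtain ⟨x, hx, h⟩ := ih
      by_cases hx0 : x = 0
      · refine ⟨0, isCanonical_zero, ?_⟩
        rw [ellipticRemainder_succ_of_eq_zero (by rw [h, hx0]; ext v; simp)]
        ext v; simp
      · obtain ⟨z, hz⟩ := hleast x hx hx0
        exact ⟨x - z, (hΓ.isGreatest_sub hx hx0 hz).1.1, ellipticRemainder_succ h hz⟩
  choose x hx hrem using hex
  have hcast : ∀ {a b : V → ℤ}, (fun v => (a v : ℚ)) = (fun v => (b v : ℚ)) → a = b := by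
    intro a b h
    ext v
    have := congrFun h v
    exact_mod_cast this
  have hx0 : IsGreatest {y | Γ.IsCanonical y} (x 0) := by
    obtain ⟨y, hy, h⟩ := hΓ.ellipticRemainder_zero
    rwa [hcast ((hrem 0).symm.trans h)]
  refine ⟨x, ⟨hx0, fun h => ?_, fun k hk => ?_, fun k v hv => ?_, fun k hk => ?_⟩, hrem⟩
  · obtain ⟨y, hy, hne⟩ := hΓ.exists_isCanonical_ne_zero
    exact hne (le_antisymm (h ▸ hx0.2 hy) hy.1)
  · obtain ⟨z, hz⟩ := hleast (x k) (hx k) hk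
    rw [hcast ((hrem (k + 1)).symm.trans (ellipticRemainder_succ (hrem k) hz))]
    exact hΓ.isGreatest_sub (hx k) hk hz
  · have hk : x k ≠ 0 := fun h => hv (by rw [h]; rfl)
    obtain ⟨z, hz⟩ := hleast (x k) (hx k) hk
    rw [hcast ((hrem (k + 1)).symm.trans (ellipticRemainder_succ (hrem k) hz))]
    have := pos_of_mem_antinefOn hΓ.isNegDef (hΓ.isLinked_intSupp (hx k)) hz.1
      (mem_intSupp.2 hv)
    simpa using this
  · have h1 : Γ.ellipticRemainder k = 0 := by rw [hrem, hk]; ext v; simp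
    have h2 := ellipticRemainder_succ_of_eq_zero h1
    rw [hrem] at h2
    exact hcast (h2.trans (by ext v; simp))

namespace IsCanonicalChain

variable {x : ℕ → V → ℤ}

theorem isCanonical (hx : Γ.IsCanonicalChain x) (k : ℕ) : Γ.IsCanonical (x k) := by
  induction k with
  | zero => exact hx.isGreatest_zero.1
  | succ k ih =>
    by_cases h : x k = 0
    · rw [hx.succ_eq_zero k h]; exact isCanonical_zero
    · exact (hx.isGreatest_succ k h).1.1

theorem succ_le (hx : Γ.IsCanonicalChain x) (k : ℕ) : x (k + 1) ≤ x k := by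
  by_cases h : x k = 0
  · rw [hx.succ_eq_zero k h, h]
  · exact (hx.isGreatest_succ k h).1.2.1

theorem antitone (hx : Γ.IsCanonicalChain x) : Antitone x := antitone_nat_of_succ_le hx.succ_le

theorem lt_of_lt (hx : Γ.IsCanonicalChain x) {j k : ℕ} (h : j < k) {v : V} (hv : x j v ≠ 0) :
    x k v < x j v :=
  lt_of_le_of_lt (hx.antitone (Nat.succ_le_of_lt h) v) (hx.succ_lt j v hv)

theorem injective_of_ne_zero (hx : Γ.IsCanonicalChain x) {j k : ℕ} (hj : x j ≠ 0)
    (h : x j = x k) : j = k := by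
  obtain ⟨v, hv⟩ := Function.ne_iff.1 hj
  rcases lt_trichotomy j k with hjk | hjk | hjk
  · have := hx.lt_of_lt hjk hv
    rw [h] at this
    exact absurd this (lt_irrefl _)
  · exact hjk
  · have := hx.lt_of_lt hjk (v := v) (by rw [← h]; exact hv)
    rw [h] at this
    exact absurd this (lt_irrefl _)

/-- A canonical `y` missed by the chain would lie below every `x k`, but at a vertex of its support
the coefficients of the chain drop at each step. -/
theorem exists_eq (hx : Γ.IsCanonicalChain x) {y : V → ℤ} (hy : Γ.IsCanonical y) (hy0 : y ≠ 0) :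
    ∃ j, y = x j := by
  by_contra! hne
  have hle : ∀ k, y ≤ x k := by
    intro k
    induction k with
    | zero => exact hx.isGreatest_zero.2 hy
    | succ k ih =>
      refine (hx.isGreatest_succ k fun h => hy0 ?_).2 ⟨hy, ih, hne k⟩
      exact le_antisymm (h ▸ ih) hy.1
  obtain ⟨v, hv⟩ := Function.ne_iff.1 hy0
  have hpos : 0 < y v := lt_of_le_of_ne (hy.1 v) (Ne.symm hv)
  have hbound : ∀ k : ℕ, x k v ≤ x 0 v - k := by
    intro k
    induction k with
    | zero => simp
    | succ k ih =>
      have h1 : 0 < x k v := lt_of_lt_of_le hpos (hle k v)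
      have h2 := hx.succ_lt k v h1.ne'
      push_cast
      omega
  have h1 := hbound (x 0 v).toNat
  have h2 : y v ≤ x (x 0 v).toNat v := hle _ v
  have h3 : y v ≤ x 0 v := hle 0 v
  omega

end IsCanonicalChain

/-! ### The index of an extension -/

/-- Canonicity only involves intersections with vertices of the support, so it does not depend on
the ambient graph. -/
theorem isCanonical_fullSubgraph_iff {S : Finset V} (y : S → ℤ) :
    (Γ.fullSubgraph S).IsCanonical y ↔ Γ.IsCanonical (extendInt S y) := by
  constructor
  · rintro ⟨h0, h⟩
    refine ⟨fun v => ?_, fun v hv => ?_⟩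
    · by_cases hv : v ∈ S
      · rw [extendInt_coe y ⟨v, hv⟩]; exact h0 _
      · rw [extendInt_of_notMem y hv]; rfl
    · have hvS : v ∈ S := by
        by_contra hvS
        exact hv (extendInt_of_notMem y hvS)
      rw [extendInt_coe y ⟨v, hvS⟩] at hv
      exact (pair_fullSubgraph y ⟨v, hvS⟩).symm.trans (h _ hv)
  · rintro ⟨h0, h⟩
    refine ⟨fun v => ?_, fun v hv => ?_⟩
    · rw [← extendInt_coe y v]; exact h0 v
    · rw [pair_fullSubgraph]
      exact h v (by rwa [extendInt_coe])

theorem extendInt_le_iff {V : Type*} {S : Finset V} {y z : S → ℤ} :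
    extendInt S y ≤ extendInt S z ↔ y ≤ z := by
  constructor
  · intro h v
    have := h v
    rwa [extendInt_coe, extendInt_coe] at this
  · intro h v
    by_cases hv : v ∈ S
    · rw [extendInt_coe y ⟨v, hv⟩, extendInt_coe z ⟨v, hv⟩]; exact h _
    · rw [extendInt_of_notMem y hv, extendInt_of_notMem z hv]

theorem extendInt_injective {V : Type*} (S : Finset V) : Function.Injective (extendInt S) :=
  fun _ _ h => le_antisymm (extendInt_le_iff.1 h.le) (extendInt_le_iff.1 h.ge)

theorem extendInt_zero {V : Type*} (S : Finset V) : extendInt S 0 = 0 := by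
  ext v; simp [extendInt]

/-- The canonical chain of an elliptic full subgraph is a tail of the canonical chain. -/
theorem IsCanonicalChain.exists_tail {S : Finset V} {x : ℕ → V → ℤ} {y : ℕ → S → ℤ}
    (hx : Γ.IsCanonicalChain x) (hy : (Γ.fullSubgraph S).IsCanonicalChain y) :
    ∃ i, x i ≠ 0 ∧ ∀ t, extendInt S (y t) = x (i + t) := by
  have hne : ∀ t, extendInt S (y t) = 0 ↔ y t = 0 := fun t => by
    rw [← extendInt_zero S]; exact (extendInt_injective S).eq_iff
  obtain ⟨i, hi⟩ := hx.exists_eq ((isCanonical_fullSubgraph_iff _).1 (hy.isCanonical 0))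
    (fun h => hy.zero_ne ((hne 0).1 h))
  refine ⟨i, fun h => hy.zero_ne ((hne 0).1 (hi.trans h)), fun t => ?_⟩
  induction t with
  | zero => exact hi
  | succ t ih =>
    rw [← add_assoc]
    by_cases h0 : y t = 0
    · rw [hy.succ_eq_zero t h0, hx.succ_eq_zero (i + t) (ih ▸ (hne t).2 h0), extendInt_zero]
    · have hx0 : x (i + t) ≠ 0 := fun h => h0 ((hne t).1 (ih.trans h))
      have hyg := hy.isGreatest_succ t h0
      -- A canonical cycle of `Γ` below `x (i + t)` is supported on `S`, so both graphs have the
      -- same competitors.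
      refine IsGreatest.unique (s := {z | Γ.IsCanonical z ∧ z ≤ x (i + t) ∧ z ≠ x (i + t)})
        ⟨⟨(isCanonical_fullSubgraph_iff _).1 hyg.1.1, ?_, ?_⟩, fun z hz => ?_⟩
        (hx.isGreatest_succ _ hx0)
      · rw [← ih]; exact extendInt_le_iff.2 hyg.1.2.1
      · rw [← ih]; exact fun h => hyg.1.2.2 (extendInt_injective S h)
      · rw [← ih] at hz
        have hzS : extendInt S (fun v => z v) = z := extendInt_restrict fun v hv => by
          have h1 := hz.2.1 v
          rw [extendInt_of_notMem _ hv] at h1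
          exact le_antisymm h1 (hz.1.1 v)
        rw [← hzS] at hz ⊢
        refine extendInt_le_iff.2 (hyg.2 ⟨(isCanonical_fullSubgraph_iff _).2 hz.1,
          extendInt_le_iff.1 hz.2.1, fun h => hz.2.2 (by rw [← h])⟩)

theorem map_supp_fullSubgraph {S : Finset V} (y : S → ℤ) :
    (supp fun v => (y v : ℚ)).map (Function.Embedding.subtype (· ∈ S)) =
      intSupp (extendInt S y) := by
  ext v
  simp only [Finset.mem_map, mem_intSupp, supp_intCast, Function.Embedding.coe_subtype]
  constructor
  · rintro ⟨w, hw, rfl⟩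
    rwa [extendInt_coe]
  · intro h
    have hvS : v ∈ S := by
      by_contra hvS
      exact h (extendInt_of_notMem y hvS)
    exact ⟨⟨v, hvS⟩, by rwa [extendInt_coe y ⟨v, hvS⟩] at h, rfl⟩

/-- The sequence records only supports, but a canonical cycle is determined by its support, so the
first set alone fixes the index. -/
theorem IsElliptic.exists_isExtensionIndex (hΓ : Γ.IsElliptic) {S : Finset V}
    (hS : (Γ.fullSubgraph S).IsElliptic) :
    ∃ (x : ℕ → V → ℤ) (y : ℕ → S → ℤ) (i : ℕ), Γ.IsCanonicalChain x ∧
      (Γ.fullSubgraph S).IsCanonicalChain y ∧ x i ≠ 0 ∧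
      (∀ t, extendInt S (y t) = x (i + t)) ∧ (∀ k, Γ.ellipticSequence k = intSupp (x k)) ∧
      ∀ j, Γ.IsExtensionIndex S j ↔ j = i := by
  obtain ⟨x, hx, hxr⟩ := hΓ.exists_isCanonicalChain
  obtain ⟨y, hy, hyr⟩ := hS.exists_isCanonicalChain
  obtain ⟨i, hi, htail⟩ := hx.exists_tail hy
  have hseq : ∀ k, Γ.ellipticSequence k = intSupp (x k) := fun k => by
    rw [ellipticSequence, hxr, supp_intCast]
  have hmap : ∀ t, ((Γ.fullSubgraph S).ellipticSequence t).map
      (Function.Embedding.subtype (· ∈ S)) = intSupp (x (i + t)) := fun t => by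
    rw [ellipticSequence, hyr, map_supp_fullSubgraph, htail]
  refine ⟨x, y, i, hx, hy, hi, htail, hseq, fun j => ⟨fun h => ?_, ?_⟩⟩
  · have h0 := h.2 0
    rw [hmap, hseq] at h0
    simp only [add_zero] at h0
    exact (hx.injective_of_ne_zero hi ((hx.isCanonical i).eq_of_intSupp_eq hΓ.isNegDef
      (hx.isCanonical j) h0)).symm
  · rintro rfl
    refine ⟨?_, fun t => by rw [hmap, hseq]⟩
    rw [hseq]
    exact intSupp_nonempty.2 hi

end

section

/-! ### Coefficients of the Poincaré series -/

/-- The coefficient of `T ^ n` in `(1 - T) ^ (d - 2)`. -/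
def factorCoeff (d : ℕ) (n : ℤ) : ℤ :=
  if n < 0 then 0
  else PowerSeries.coeff n.toNat ((1 - PowerSeries.X : PowerSeries ℤ) ^ d * PowerSeries.mk 1 ^ 2)

theorem factorCoeff_of_neg (d : ℕ) {n : ℤ} (hn : n < 0) : factorCoeff d n = 0 := if_pos hn

theorem mk_one_mul_one_sub_X :
    (PowerSeries.mk 1 : PowerSeries ℤ) * (1 - PowerSeries.X) = 1 :=
  PowerSeries.mk_one_mul_one_sub_eq_one ℤ

/-- At an end-vertex the series is geometric, so its coefficient sees only the sign of the defect.
-/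
theorem factorCoeff_one (n : ℤ) : factorCoeff 1 n = if 0 ≤ n then 1 else 0 := by
  unfold factorCoeff
  have h : (1 - PowerSeries.X : PowerSeries ℤ) ^ 1 * PowerSeries.mk 1 ^ 2 = PowerSeries.mk 1 := by
    rw [pow_one, pow_two, ← mul_assoc, mul_comm (1 - PowerSeries.X : PowerSeries ℤ),
      mk_one_mul_one_sub_X, one_mul]
  rw [h]
  split_ifs <;> first | omega | simp

theorem factorCoeff_succ (d : ℕ) (n : ℤ) :
    factorCoeff (d + 1) n = factorCoeff d n - factorCoeff d (n - 1) := by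
  unfold factorCoeff
  set f : PowerSeries ℤ := (1 - PowerSeries.X) ^ d * PowerSeries.mk 1 ^ 2 with hf
  have h : (1 - PowerSeries.X : PowerSeries ℤ) ^ (d + 1) * PowerSeries.mk 1 ^ 2 =
      f - f * PowerSeries.X := by rw [hf]; ring
  rw [h]
  rcases lt_trichotomy n 0 with h0 | rfl | h0
  · simp [h0, show n - 1 < 0 by omega]
  · simp
  · obtain ⟨k, hk⟩ : ∃ k : ℕ, n = k + 1 := ⟨(n - 1).toNat, by omega⟩
    subst hk
    have h1 : ¬ ((k : ℤ) + 1 < 0) := by omega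
    have h2 : ¬ ((k : ℤ) + 1 - 1 < 0) := by omega
    have h3 : ((k : ℤ) + 1).toNat = k + 1 := by omega
    have h4 : ((k : ℤ) + 1 - 1).toNat = k := by omega
    rw [if_neg h1, if_neg h1, if_neg h2, h3, h4, map_sub, PowerSeries.coeff_succ_mul_X]

/-- The sum over a leg of the weights of a vertex lowers its valency by one. -/
theorem sum_factorCoeff_succ (d : ℕ) (c : ℤ) (a M : ℕ) (haM : a ≤ M) (hM : c < M) :
    ∑ b ∈ Finset.Ico a M, factorCoeff (d + 1) (c - b) = factorCoeff d (c - a) := by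
  -- The sum telescopes; the boundary term at `M` vanishes because `c < M`.
  have h := Finset.sum_Ico_sub (fun b : ℕ => -factorCoeff d (c - b)) haM
  rw [factorCoeff_of_neg d (show c - (M : ℤ) < 0 by omega), neg_zero, zero_sub, neg_neg] at h
  rw [← h]
  refine Finset.sum_congr rfl fun b _ => ?_
  rw [factorCoeff_succ]
  push_cast
  rw [show c - (b : ℤ) - 1 = c - (b + 1) by ring]
  ring

theorem rename_factor {V : Type*} (v : V) (d : ℕ) :
    MvPowerSeries.rename (fun _ : Unit => v)
      ((1 - PowerSeries.X : PowerSeries ℤ) ^ d * PowerSeries.mk 1 ^ 2) =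
    (1 - MvPowerSeries.X v) ^ d * MvPowerSeries.invOfUnit (1 - MvPowerSeries.X v) 1 ^ 2 := by
  have hX : MvPowerSeries.rename (fun _ : Unit => v) (1 - PowerSeries.X : PowerSeries ℤ) =
      1 - MvPowerSeries.X v := by
    rw [map_sub, map_one]
    congr 1
    exact MvPowerSeries.rename_X _ _
  have h1 : MvPowerSeries.rename (fun _ : Unit => v) (PowerSeries.mk 1 : PowerSeries ℤ) *
      (1 - MvPowerSeries.X v) = 1 := by
    rw [← hX, ← map_mul, mk_one_mul_one_sub_X, map_one]
  have h2 : (1 - MvPowerSeries.X v : MvPowerSeries V ℤ) *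
      MvPowerSeries.invOfUnit (1 - MvPowerSeries.X v) 1 = 1 :=
    MvPowerSeries.mul_invOfUnit _ _ (by simp)
  rw [map_mul, map_pow, map_pow, hX, left_inv_eq_right_inv h1 h2]

theorem coeff_rename_unit {V : Type*} (v : V) (f : PowerSeries ℤ) (d : V →₀ ℕ) :
    MvPowerSeries.coeff d (MvPowerSeries.rename (fun _ : Unit => v) f) =
      if d = Finsupp.single v (d v) then PowerSeries.coeff (d v) f else 0 := by
  have hemb : ∀ n : ℕ, Finsupp.embDomain (⟨fun _ : Unit => v, fun _ _ _ => rfl⟩ : Unit ↪ V)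
      (Finsupp.single () n) = Finsupp.single v n := fun n => by
    rw [Finsupp.embDomain_single]; rfl
  split_ifs with h
  · have := MvPowerSeries.coeff_embDomain_rename
      (⟨fun _ : Unit => v, fun _ _ _ => rfl⟩ : Unit ↪ V) f (Finsupp.single () (d v))
    rw [hemb] at this
    conv_lhs => rw [h]
    exact this
  · refine MvPowerSeries.coeff_rename_eq_zero _ _ ?_
    rintro ⟨e, rfl⟩
    refine h ?_
    rw [Finsupp.unique_single e, Finsupp.mapDomain_single, Finsupp.single_eq_same]

/-- The factors live in distinct variables, so only the splitting of `d` into its coordinates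
contributes. -/
theorem coeff_poincareSeries {V : Type*} [Fintype V] (Γ : PlumbingGraph V) (d : V →₀ ℕ) :
    MvPowerSeries.coeff d Γ.poincareSeries = ∏ v, factorCoeff (Γ.valency v) (d v) := by
  have hfac : Γ.poincareSeries = ∏ v, MvPowerSeries.rename (fun _ : Unit => v)
      ((1 - PowerSeries.X : PowerSeries ℤ) ^ Γ.valency v * PowerSeries.mk 1 ^ 2) :=
    Finset.prod_congr rfl fun v _ => (rename_factor v _).symm
  rw [hfac, MvPowerSeries.coeff_prod]
  simp only [coeff_rename_unit]
  have hd : d = ∑ v, Finsupp.single v (d v) := by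
    rw [← Finsupp.sum_fintype d (fun v n => Finsupp.single v n) (by simp)]
    exact (Finsupp.sum_single d).symm
  set e : V →₀ (V →₀ ℕ) := Finsupp.equivFunOnFinite.symm fun v => Finsupp.single v (d v) with he
  rw [Finset.sum_eq_single e]
  · refine Finset.prod_congr rfl fun v _ => ?_
    have : e v = Finsupp.single v (d v) := rfl
    rw [this, Finsupp.single_eq_same, if_pos rfl, factorCoeff, if_neg (by omega), Int.toNat_natCast]
  · intro l hl hne
    rw [Finset.mem_finsuppAntidiag] at hl
    by_contra hprod
    rw [← ne_eq, Finset.prod_ne_zero_iff] at hprod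
    have hl1 : ∀ v, l v = Finsupp.single v (l v v) := by
      intro v
      by_contra h
      exact hprod v (Finset.mem_univ v) (if_neg h)
    refine hne (Finsupp.ext fun v => ?_)
    have hdv : d v = l v v := by
      rw [← hl.1, Finset.sum_apply', Finset.sum_eq_single v]
      · intro b _ hb
        rw [hl1 b]
        simp [hb]
      · simp
    rw [hl1 v, ← hdv]
    rfl
  · intro h
    refine absurd (Finset.mem_finsuppAntidiag.2 ⟨?_, Finset.subset_univ _⟩) h
    exact hd.symm

variable {V : Type*} [Fintype V] {Γ : PlumbingGraph V}

/-- The multiplicity `-(Z_K + r, E_v)`. -/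
def defect (Γ : PlumbingGraph V) (r : V → ℤ) (v : V) : ℤ := -(Γ.pair r v + Γ.euler v + 2)

/-- The coefficient of `t ^ (Z_K + r)` in the Poincaré series. -/
def weight (Γ : PlumbingGraph V) (r : V → ℤ) : ℤ :=
  ∏ v, factorCoeff (Γ.valency v) (Γ.defect r v)

theorem defect_nonneg_of_weight_ne_zero {r : V → ℤ} (h : Γ.weight r ≠ 0) (v : V) :
    0 ≤ Γ.defect r v := by
  by_contra! hv
  exact Finset.prod_ne_zero_iff.1 h v (Finset.mem_univ v) (factorCoeff_of_neg _ hv)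

/-- Outside the Lipman monoid some defect is negative and its factor is zero, so the case
distinction is absorbed into the product. -/
theorem poincareCoeff_eq_weight (hΓ : Γ.IsNegDef) (r : V → ℤ) :
    Γ.poincareCoeff (Γ.antiCanonicalCycle + fun v => (r v : ℚ)) = Γ.weight r := by
  have hform : ∀ v, Γ.form (Γ.antiCanonicalCycle + fun v => (r v : ℚ)) (E v) =
      ((-Γ.defect r v : ℤ) : ℚ) := by
    intro v
    rw [form_add_E, form_antiCanonicalCycle hΓ, form_E_intCast, defect]; push_cast; ring
  unfold poincareCoeff
  split_ifs with h
  · rw [coeff_poincareSeries]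
    refine Finset.prod_congr rfl fun v _ => ?_
    have h1 := h.2 v
    rw [hform] at h1
    have h2 : 0 ≤ Γ.defect r v := by
      have : -Γ.defect r v ≤ 0 := by exact_mod_cast h1
      omega
    obtain ⟨n, hn⟩ := Int.eq_ofNat_of_zero_le h2
    rw [Finsupp.coe_equivFunOnFinite_symm, hform, hn]
    push_cast
    rw [neg_neg, Nat.floor_natCast]
  · by_contra hne
    refine h ⟨fun v => ⟨_, hform v⟩, fun v => ?_⟩
    rw [hform]
    have := defect_nonneg_of_weight_ne_zero (Ne.symm hne) v
    exact_mod_cast neg_nonpos.2 this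

theorem canonicalCoeff_eq (hΓ : Γ.IsNegDef) (l : V → ℤ) :
    Γ.canonicalCoeff l = if ∀ v, l v < 0 then 0 else Γ.weight (-l - 1) := by
  unfold canonicalCoeff
  congr 1
  rw [← poincareCoeff_eq_weight hΓ]
  congr 1
  ext v
  simp
  ring

end

section

variable {V : Type*} [Fintype V] {Γ : PlumbingGraph V}

/-! ### Minimal extensions of cycles -/

/-- The integral cycles which agree with `r₀` on `A`, and which are effective with
intersection numbers bounded by `c` away from `A`. -/
def boundedExtensions (Γ : PlumbingGraph V) (c : V → ℤ) (A : Finset V) (r₀ : V → ℤ) :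
    Set (V → ℤ) :=
  {r | (∀ v ∈ A, r v = r₀ v) ∧ ∀ v ∉ A, 0 ≤ r v ∧ Γ.pair r v ≤ c v}

theorem exists_isLeast_boundedExtensions (hΓ : Γ.IsNegDef) {c : V → ℤ} (hc : 0 ≤ c)
    (A : Finset V) (r₀ : V → ℤ) : ∃ m, IsLeast (Γ.boundedExtensions c A r₀) m := by
  refine exists_isLeast ?_ (fun v => if v ∈ A then r₀ v else 0) (fun r hr v => ?_)
    fun r hr s hs => ⟨fun v hv => ?_, fun v hv => ?_⟩
  · obtain ⟨W, hW0, hW⟩ := exists_pair_neg hΓ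
    -- The prescribed values on `A` contribute at most `N` to an intersection number, and `N * W`
    -- contributes at most `-N`.
    set N : ℤ := ∑ w, |r₀ w| with hN
    have hN0 : 0 ≤ N := Finset.sum_nonneg fun w _ => abs_nonneg _
    refine ⟨fun v => if v ∈ A then r₀ v else N * W v, fun v hv => by simp [hv], fun v hv => ?_⟩
    refine ⟨by simpa [hv] using mul_nonneg hN0 (hW0 v), le_trans ?_ (hc v)⟩
    have h1 : Γ.pair (fun v => if v ∈ A then r₀ v else N * W v) v ≤
        Γ.pair ((fun w => N * W w) + fun w => if w ∈ A then |r₀ w| else 0) v := by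
      refine pair_le_pair (by simp [hv]) fun w _ => ?_
      by_cases hw : w ∈ A
      · simp only [hw, if_true, Pi.add_apply]
        have := mul_nonneg hN0 (hW0 w)
        have := le_abs_self (r₀ w)
        omega
      · simp [hw]
    have h2 : Γ.pair (fun w => if w ∈ A then |r₀ w| else 0) v ≤ N := by
      simp only [pair, hv, if_false, mul_zero, zero_add]
      refine Finset.sum_le_sum fun w _ => ?_
      split_ifs
      · exact le_rfl
      · exact abs_nonneg _
      · exact abs_nonneg _
    rw [pair_add, pair_smul] at h1
    have h3 := mul_le_mul_of_nonneg_left (hW v) hN0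
    simp only [Pi.zero_apply]
    linarith
  · by_cases hv : v ∈ A
    · simp [hv, hr.1 v hv]
    · simpa [hv] using (hr.2 v hv).1
  · simp [hr.1 v hv, hs.1 v hv]
  · refine ⟨le_min (hr.2 v hv).1 (hs.2 v hv).1, ?_⟩
    rcases pair_inf_le (Γ := Γ) r s v with h | h
    · exact h.2.trans (hr.2 v hv).2
    · exact h.2.trans (hs.2 v hv).2

/-- Passing to the minimal anti-nef extension does not increase `χ`. -/
theorem twoChi_le_of_isLeast {A : Finset V} {l m : V → ℤ} (hl : ∀ v ∉ A, 0 ≤ l v)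
    (hm : IsLeast (Γ.boundedExtensions 0 A l) m) {w : V → ℤ} (hlw : l ≤ w) (hwm : w ≤ m)
    (hw : ∀ v ∈ A, w v = l v) : Γ.twoChi m ≤ Γ.twoChi w := by
  induction hn : (∑ v, (m v - w v)).toNat using Nat.strong_induction_on generalizing w with
  | _ n ih =>
  have hnn : ∀ w : V → ℤ, w ≤ m → 0 ≤ ∑ v, (m v - w v) := fun w hw =>
    Finset.sum_nonneg fun v _ => sub_nonneg.2 (hw v)
  by_cases heq : w = m
  · rw [heq]
  -- A computation sequence: as long as `w` is not minimal anti-nef off `A`, adding a vertex with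
  -- `(w, E_v) > 0` stays below `m` and does not raise `χ`.
  · obtain ⟨v, hvA, hv⟩ : ∃ v ∉ A, 0 < Γ.pair w v := by
      by_contra! h
      exact heq (le_antisymm hwm (hm.2 ⟨hw, fun v hv => ⟨(hl v hv).trans (hlw v), h v hv⟩⟩))
    have hlt : w v < m v := by
      refine lt_of_le_of_ne (hwm v) fun he => ?_
      have h1 := pair_le_pair (Γ := Γ) he fun u _ => hwm u
      have h2 := (hm.1.2 v hvA).2
      simp only [Pi.zero_apply] at h2
      omega
    have hstep := twoChi_add_single (Γ := Γ) w v
    have hwm' : w + Pi.single v 1 ≤ m := by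
      intro u
      by_cases hu : u = v
      · subst hu; simpa using hlt
      · simpa [hu] using hwm u
    have hsum : ∑ u, (m u - (w + Pi.single v 1 : V → ℤ) u) = ∑ u, (m u - w u) - 1 := by
      simp only [Pi.add_apply, ← sub_sub]
      rw [Finset.sum_sub_distrib]
      simp
    refine (ih _ ?_ (hlw.trans (le_add_of_nonneg_right (Pi.single_nonneg.2 zero_le_one))) hwm'
      (fun u hu => ?_) rfl).trans (by omega)
    · have := hnn w hwm
      have := hnn _ hwm'
      omega
    · have : u ≠ v := fun h => hvA (h ▸ hu)
      simp [this, hw u hu]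

/-- Along an end-vertex `t` of `A` of multiplicity one in a cycle `l` with `χ(l) = 0`,
the minimal anti-nef extension of `E_t` is anti-nef at `t` as well. -/
theorem IsElliptic.exists_antinef_extension (hΓ : Γ.IsElliptic) {A : Finset V} {l : V → ℤ}
    (hl : 0 ≤ l) (hlχ : Γ.twoChi l = 0) (hlA : intSupp l = A) {t u : V} (ht : l t = 1)
    (hu : u ∈ A) (htu : Γ.graph.Adj t u) :
    ∃ Z : V → ℤ, 0 ≤ Z ∧ (∀ v ∈ A, Z v = 0) ∧
      ∀ v, v ∉ A ∨ v = t → Γ.pair (Z + Pi.single t 1) v ≤ 0 := by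
  have hl0 : ∀ v ∉ A, l v = 0 := fun v hv => by
    rw [← hlA] at hv; simpa using hv
  obtain ⟨m, hm⟩ := exists_isLeast_boundedExtensions hΓ.isNegDef (le_refl 0) A l
  have hlm : l ≤ m := fun v => by
    by_cases hv : v ∈ A
    · exact (hm.1.1 v hv).ge
    · rw [hl0 v hv]; exact (hm.1.2 v hv).1
  have hmχ : Γ.twoChi m = 0 := le_antisymm
    ((twoChi_le_of_isLeast (fun v _ => hl v) hm le_rfl hlm fun _ _ => rfl).trans hlχ.le)
    (hΓ.twoChi_nonneg (hl.trans hlm))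
  have hlt : 0 ≤ l - Pi.single t 1 := by
    intro v
    by_cases hv : v = t
    · subst hv; simp [ht]
    · simpa [hv] using hl v
  have hsplit : ∀ v, Γ.pair (m - l + Pi.single t 1) v =
      Γ.pair m v - Γ.pair (l - Pi.single t 1) v := fun v => by
    rw [← pair_sub]; congr 1; abel
  refine ⟨m - l, sub_nonneg.2 hlm, fun v hv => ?_, fun v hv => ?_⟩
  · simp [hm.1.1 v hv]
  · rw [hsplit]
    rcases hv with hv | rfl
    · have htA : t ∈ A := by rw [← hlA]; simp [ht]
      have hvt : v ≠ t := fun h => hv (h ▸ htA)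
      have h1 := (hm.1.2 v hv).2
      have h2 := pair_nonneg (Γ := Γ) (x := l - Pi.single t 1) (v := v)
        (by simp [hvt, hl0 v hv]) fun w _ => hlt w
      simp only [Pi.zero_apply] at h1
      omega
    -- At `t`, `χ(m) = 0 ≤ χ(m + E_t)` gives `(m, E_t) ≤ 1`. The cycle `l - E_t` vanishes at `t`, so
    -- through `u` it meets `E_t` at least once.
    · have h1 := twoChi_add_single (Γ := Γ) m v
      have h2 := hΓ.twoChi_nonneg (l := m + Pi.single v 1)
        (add_nonneg (hl.trans hlm) (Pi.single_nonneg.2 zero_le_one))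
      have h3 : 1 ≤ Γ.pair (l - Pi.single v 1) v := by
        refine one_le_pair (by simp [ht]) hlt htu ?_
        have hlu : l u ≠ 0 := by rwa [← mem_intSupp, hlA]
        have := hl u
        simp only [Pi.zero_apply] at this
        simp only [Pi.sub_apply, Pi.single_apply, htu.ne', if_false]
        omega
      omega

/-- Adding adjacent vertices one by one keeps `χ = 0`. The new multiplicities are one, as
`IsElliptic.exists_antinef_extension` requires at the added vertex. -/
theorem IsElliptic.exists_intSupp_eq (hΓ : Γ.IsElliptic) {A : Finset V}
    (hA : IsLinked Γ.graph A) {l : V → ℤ} (hl : 0 ≤ l) (hl0 : l ≠ 0) (hlχ : Γ.twoChi l = 0)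
    (hlA : intSupp l ⊆ A) :
    ∃ k : V → ℤ, 0 ≤ k ∧ Γ.twoChi k = 0 ∧ intSupp k = A ∧
      ∀ v ∈ A, k v = if l v = 0 then 1 else l v := by
  induction hn : (A \ intSupp l).card using Nat.strong_induction_on generalizing l with
  | _ n ih =>
  by_cases heq : intSupp l = A
  · refine ⟨l, hl, hlχ, heq, fun v hv => ?_⟩
    rw [← heq, mem_intSupp] at hv
    rw [if_neg hv]
  · obtain ⟨v, hv, w, hwA, hw, hvw⟩ := hA.exists_adj hlA (intSupp_nonempty.2 hl0) heq
    have hlw : l w = 0 := by simpa using hw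
    have hp : 1 ≤ Γ.pair l w := one_le_pair hlw hl hvw.symm
      (lt_of_le_of_ne (hl v) (Ne.symm (mem_intSupp.1 hv)))
    have hs : intSupp (l + Pi.single w 1) = insert w (intSupp l) := by
      ext u
      by_cases hu : u = w
      · subst hu; simp [hlw]
      · simp [hu]
    obtain ⟨k, hk0, hkχ, hkA, hk⟩ := ih _ (by
        rw [← hn, hs]
        refine Finset.card_lt_card ((Finset.ssubset_iff_of_subset
          (Finset.sdiff_subset_sdiff le_rfl (Finset.subset_insert _ _))).2 ⟨w, ?_, ?_⟩)
        · exact Finset.mem_sdiff.2 ⟨hwA, hw⟩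
        · simp)
      (add_nonneg hl (Pi.single_nonneg.2 zero_le_one))
      (by rw [← intSupp_nonempty, hs]; exact Finset.insert_nonempty _ _)
      (hΓ.twoChi_add_single_eq_zero hl hlχ hp)
      (by rw [hs]; exact Finset.insert_subset hwA hlA) rfl
    refine ⟨k, hk0, hkχ, hkA, fun u huA => ?_⟩
    rw [hk u huA]
    by_cases huw : u = w
    · subst huw; simp [hlw]
    · simp [huw]

/-! ### Cutting a tree at an edge -/

/-- Take for `K` the component of `t` after deleting the bridge `tu`; the connected set `A` avoids
`t` and so stays on the side of `u`. -/
theorem exists_branch {V : Type*} [Fintype V] {G : SimpleGraph V} (hG : G.IsAcyclic)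
    {A : Finset V} (hA : IsLinked G A) {t u : V} (ht : t ∉ A) (hu : u ∈ A) (htu : G.Adj t u) :
    ∃ K : Finset V, t ∈ K ∧ (∀ v ∈ A, v ∉ K) ∧
      ∀ v ∈ K, ∀ w ∉ K, G.Adj v w → v = t ∧ w = u := by
  set H := G.deleteEdges {s(t, u)} with hH
  have hbr : ¬ H.Reachable t u :=
    SimpleGraph.isBridge_iff.1 (SimpleGraph.isAcyclic_iff_forall_adj_isBridge.1 hG htu)
  have hadj : ∀ {v w}, G.Adj v w → s(v, w) ≠ s(t, u) → H.Adj v w := fun h hne => by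
    rw [hH, SimpleGraph.deleteEdges_adj]
    exact ⟨h, hne⟩
  have hAK : ∀ v ∈ A, ¬ H.Reachable t v := by
    have hC := hA (A.filter fun v => ¬ H.Reachable t v) (Finset.filter_subset _ _)
      ⟨u, Finset.mem_filter.2 ⟨hu, hbr⟩⟩ fun v hv w hw hvw => by
        rw [Finset.mem_filter] at hv ⊢
        refine ⟨hw, fun h => hv.2 (h.trans (hadj hvw.symm fun he => ?_).reachable)⟩
        rcases Sym2.eq_iff.1 he with ⟨h1, -⟩ | ⟨-, h1⟩
        · exact ht (h1 ▸ hw)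
        · exact ht (h1 ▸ hv.1)
    intro v hv
    rw [← hC] at hv
    exact (Finset.mem_filter.1 hv).2
  refine ⟨Finset.univ.filter fun v => H.Reachable t v, by simp, fun v hv => ?_,
    fun v hv w hw hvw => ?_⟩
  · simpa using hAK v hv
  · simp only [Finset.mem_filter, Finset.mem_univ, true_and] at hv hw
    by_cases he : s(v, w) = s(t, u)
    · rcases Sym2.eq_iff.1 he with h | ⟨rfl, rfl⟩
      · exact h
      · exact absurd hv hbr
    · exact absurd (hv.trans (hadj hvw he).reachable) hw

/-! ### Elimination of end-vertices -/

theorem IsElliptic.exists_isLeast_extension (hΓ : Γ.IsElliptic) (A : Finset V) (r₀ : V → ℤ) :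
    ∃ m, IsLeast (Γ.boundedExtensions (fun v => -2 - Γ.euler v) A r₀) m :=
  exists_isLeast_boundedExtensions hΓ.isNegDef (fun v => by
    have := hΓ.isMinimal v
    simp only [Pi.zero_apply]
    omega) A r₀

/-- The minimal cycle which agrees with `r₀` on `A`, and which is effective with nonnegative
`defect` away from `A`. -/
def minExtension (Γ : PlumbingGraph V) (A : Finset V) (r₀ : V → ℤ) : V → ℤ :=
  if h : ∃ m, IsLeast (Γ.boundedExtensions (fun v => -2 - Γ.euler v) A r₀) m then h.choose else 0

theorem IsElliptic.isLeast_minExtension (hΓ : Γ.IsElliptic) (A : Finset V) (r₀ : V → ℤ) :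
    IsLeast (Γ.boundedExtensions (fun v => -2 - Γ.euler v) A r₀) (Γ.minExtension A r₀) := by
  rw [minExtension, dif_pos (hΓ.exists_isLeast_extension A r₀)]
  exact (hΓ.exists_isLeast_extension A r₀).choose_spec

/-- The minimal extension is independent, away from a branch, of the multiplicity
at the root of the branch. -/
theorem IsElliptic.minExtension_insert_eq (hΓ : Γ.IsElliptic) {A K : Finset V} {t u : V}
    (ht : t ∈ K) (hu : u ∈ A)
    (hK : ∀ v ∈ K, ∀ w ∉ K, Γ.graph.Adj v w → v = t ∧ w = u) (r₀ : V → ℤ) (a b : ℤ) {v : V}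
    (hv : v ∉ K) : Γ.minExtension (insert t A) (Function.update r₀ t a) v =
      Γ.minExtension (insert t A) (Function.update r₀ t b) v := by
  suffices h : ∀ a b : ℤ, Γ.minExtension (insert t A) (Function.update r₀ t a) v ≤
      Γ.minExtension (insert t A) (Function.update r₀ t b) v from le_antisymm (h a b) (h b a)
  intro a b
  set m := Γ.minExtension (insert t A) (Function.update r₀ t a)
  set n := Γ.minExtension (insert t A) (Function.update r₀ t b)
  have hm := hΓ.isLeast_minExtension (insert t A) (Function.update r₀ t a)
  have hn := hΓ.isLeast_minExtension (insert t A) (Function.update r₀ t b)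
  -- Gluing along the branch is harmless: the only edge leaving `K` joins `t` and `u`, where no
  -- bound is imposed.
  have hmem : (fun w => if w ∈ K then m w else n w) ∈
      Γ.boundedExtensions (fun v => -2 - Γ.euler v) (insert t A) (Function.update r₀ t a) := by
    refine ⟨fun w hw => ?_, fun w hw => ?_⟩
    · by_cases hwK : w ∈ K
      · simpa [hwK] using hm.1.1 w hw
      · have hwt : w ≠ t := fun h => hwK (h ▸ ht)
        have := hn.1.1 w hw
        simp only [Function.update_of_ne hwt] at this ⊢
        simpa [hwK] using this
    · have hwt : w ≠ t := fun h => hw (h ▸ Finset.mem_insert_self _ _)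
      have hwu : w ≠ u := fun h => hw (h ▸ Finset.mem_insert_of_mem hu)
      by_cases hwK : w ∈ K
      · rw [pair_congr (y := m) (by simp [hwK]) fun x hx => ?_]
        · simpa [hwK] using hm.1.2 w hw
        · have hxK : x ∈ K := by
            by_contra hxK
            exact hwt (hK w hwK x hxK hx).1
          simp [hxK]
      · rw [pair_congr (y := n) (by simp [hwK]) fun x hx => ?_]
        · simpa [hwK] using hn.1.2 w hw
        · have hxK : x ∉ K := fun hxK => hwu (hK x hxK w hwK hx.symm).2
          simp [hxK]
  simpa [hv] using hm.2 hmem v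

/-- How the minimal extension depends on the multiplicity `a` at a vertex `t` adjacent to `A`:
its `defect` at `t` is nonnegative from the multiplicity of the minimal extension
from `A` on, and the neighbour `u` in `A` is the only vertex of `A` where the `defect` varies. -/
theorem IsElliptic.defect_minExtension_insert (hΓ : Γ.IsElliptic) {A : Finset V}
    (hA : IsLinked Γ.graph A) {l : V → ℤ} (hl : 0 ≤ l) (hlχ : Γ.twoChi l = 0) {t u : V}
    (hlA : intSupp l = insert t A) (hlt : l t = 1) (ht : t ∉ A) (hu : u ∈ A)
    (htu : Γ.graph.Adj t u) (r₀ : V → ℤ) :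
    ∃ d : ℕ,
      (∀ a : ℕ, 0 ≤ Γ.defect (Γ.minExtension (insert t A) (Function.update r₀ t a)) t ↔ d ≤ a) ∧
      (∀ a : ℕ, ∀ v ∈ A, v ≠ u →
        Γ.defect (Γ.minExtension (insert t A) (Function.update r₀ t a)) v =
          Γ.defect (Γ.minExtension A r₀) v) ∧
      ∀ a : ℕ, Γ.defect (Γ.minExtension (insert t A) (Function.update r₀ t a)) u =
          Γ.defect (Γ.minExtension A r₀) u + d - a := by
  obtain ⟨K, htK, hAK, hK⟩ := exists_branch hΓ.isTree.isAcyclic hA ht hu htu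
  obtain ⟨Z, hZ0, hZA, hZ⟩ := hΓ.exists_antinef_extension hl hlχ hlA hlt
    (Finset.mem_insert_of_mem hu) htu
  set m := Γ.minExtension A r₀
  set p : ℕ → V → ℤ := fun a => Γ.minExtension (insert t A) (Function.update r₀ t a)
  have hm := hΓ.isLeast_minExtension A r₀
  have hp : ∀ a : ℕ, IsLeast (Γ.boundedExtensions (fun v => -2 - Γ.euler v) (insert t A)
      (Function.update r₀ t a)) (p a) := fun a => hΓ.isLeast_minExtension _ _
  have hpt : ∀ a : ℕ, p a t = a := fun a => by
    simpa using (hp a).1.1 t (Finset.mem_insert_self _ _)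
  have hne : ∀ v ∈ A, v ≠ t := fun v hv h => ht (h ▸ hv)
  have hpA : ∀ a : ℕ, ∀ v ∈ A, p a v = r₀ v := fun a v hv => by
    simpa [hne v hv] using (hp a).1.1 v (Finset.mem_insert_of_mem hv)
  have hmt := hm.1.2 t ht
  -- The threshold `d` is the multiplicity at `t` of the minimal extension from `A`.
  obtain ⟨d, hd⟩ := Int.eq_ofNat_of_zero_le hmt.1
  change m t = d at hd
  have hdefect : ∀ {r : V → ℤ} {v : V}, 0 ≤ Γ.defect r v ↔ Γ.pair r v ≤ -2 - Γ.euler v := by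
    intro r v
    unfold defect
    constructor <;> intro h <;> linarith
  have hmem : ∀ a : ℕ, 0 ≤ Γ.defect (p a) t →
      p a ∈ Γ.boundedExtensions (fun v => -2 - Γ.euler v) A r₀ := by
    refine fun a ha => ⟨hpA a, fun v hv => ?_⟩
    by_cases hvt : v = t
    · subst hvt
      exact ⟨by rw [hpt]; positivity, hdefect.1 ha⟩
    · exact (hp a).1.2 v (by simp [hvt, hv])
  have hpm : p d ≤ m := (hp d).2 <| by
    refine ⟨fun v hv => ?_, fun v hv => hm.1.2 v fun h => hv (Finset.mem_insert_of_mem h)⟩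
    rcases Finset.mem_insert.1 hv with rfl | h
    · simpa using hd
    · simpa [hne v h] using hm.1.1 v h
  have hpd : 0 ≤ Γ.defect (p d) t := hdefect.2 <|
    (pair_le_pair (by rw [hpt]; exact hd.symm) fun w _ => hpm w).trans hmt.2
  have hmp : p d = m := le_antisymm hpm (hm.2 (hmem d hpd))
  have hoff : ∀ a : ℕ, ∀ v ∉ K, p a v = m v := fun a v hv => by
    rw [← hmp]
    exact hΓ.minExtension_insert_eq htK hu hK r₀ a d hv
  refine ⟨d, fun a => ⟨fun ha => ?_, fun ha => ?_⟩, fun a v hv hvu => ?_, fun a => ?_⟩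
  · have : m t ≤ p a t := hm.2 (hmem a ha) t
    rw [hpt, hd] at this
    exact Int.ofNat_le.1 this
  · induction a, ha using Nat.le_induction with
    | base => exact hpd
    | succ a _ ih =>
      refine le_trans ih ?_
      -- Raising the multiplicity at `t` by one costs at most `Z + E_t`, which is anti-nef at `t`,
      -- so the defect at `t` cannot decrease.
      have hle : p (a + 1) ≤ p a + (Z + Pi.single t 1) := (hp (a + 1)).2 <| by
        refine ⟨fun v hv => ?_, fun v hv => ?_⟩
        · rcases Finset.mem_insert.1 hv with rfl | h
          · simp [hpt, hZA v hv]
          · simp [hne v h, hpA a v h, hZA v hv]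
        · have hvt : v ≠ t := fun h => hv (h ▸ Finset.mem_insert_self _ _)
          have h1 := (hp a).1.2 v hv
          refine ⟨?_, ?_⟩
          · have := hZ0 v
            simp only [Pi.zero_apply] at this
            simp only [Pi.add_apply, Pi.single_apply, hvt, if_false, add_zero]
            linarith [h1.1]
          · rw [pair_add]
            linarith [h1.2, hZ v (Or.inl hv)]
      have h1 := pair_le_pair (Γ := Γ) (v := t) (x := p (a + 1)) (y := p a + (Z + Pi.single t 1))
        (by simp [hpt, hZA t (Finset.mem_insert_self _ _)]) fun w _ => hle w
      rw [pair_add] at h1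
      have h2 := hZ t (Or.inr rfl)
      change Γ.defect (p a) t ≤ Γ.defect (p (a + 1)) t
      unfold defect
      linarith
  · have : Γ.pair (p a) v = Γ.pair m v := pair_congr (hoff a v (hAK v hv)) fun w hw => by
      by_cases hwK : w ∈ K
      · exact absurd (hK w hwK v (hAK v hv) hw.symm).2 hvu
      · exact hoff a w hwK
    change Γ.defect (p a) v = Γ.defect m v
    unfold defect
    rw [this]
  -- Off the branch the extensions agree, so `u` notices only the change at its neighbour `t`.
  · have h1 : Γ.pair (p a - m) u = Γ.pair (fun w => (a - d : ℤ) * (Pi.single t 1 : V → ℤ) w) u := by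
      refine pair_congr ?_ fun w hw => ?_
      · simp [hoff a u (hAK u hu), htu.ne']
      · by_cases hwK : w ∈ K
        · obtain rfl := (hK w hwK u (hAK u hu) hw.symm).1
          simp [hpt, hd]
        · have hwt : w ≠ t := fun h => hwK (h ▸ htK)
          simp [hoff a w hwK, hwt]
    rw [pair_sub, pair_smul, pair_single_of_ne htu.ne', if_pos htu.symm] at h1
    change Γ.defect (p a) u = Γ.defect m u + d - a
    unfold defect
    linarith

end

/-! ### Valencies in subgraphs and fibre sums of weights. -/

section

variable {V : Type*} {Γ : PlumbingGraph V}

/-- The valency of `v` in the full subgraph on `A`. -/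
def valencyIn (Γ : PlumbingGraph V) (A : Finset V) (v : V) : ℕ :=
  (A.filter fun w => Γ.graph.Adj v w).card

theorem valencyIn_univ [Fintype V] (v : V) : Γ.valencyIn Finset.univ v = Γ.valency v := by
  rw [valency, ← SimpleGraph.card_neighborFinset_eq_degree, SimpleGraph.neighborFinset_eq_filter]
  rfl

theorem valencyIn_coe {S : Finset V} (v : S) :
    Γ.valencyIn S v = (Γ.fullSubgraph S).valency v := by
  rw [← valencyIn_univ, valencyIn, valencyIn, ← Finset.card_map (Function.Embedding.subtype (· ∈ S))]
  congr 1
  ext w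
  simp only [Finset.mem_filter, Finset.mem_map, Finset.mem_univ, true_and,
    Function.Embedding.coe_subtype]
  constructor
  · rintro ⟨hw, h⟩
    exact ⟨⟨w, hw⟩, h, rfl⟩
  · rintro ⟨x, h, rfl⟩
    exact ⟨x.2, h⟩

theorem valencyIn_insert {A : Finset V} {t u : V} (ht : t ∉ A) (hu : u ∈ A)
    (htu : Γ.graph.Adj t u) (huniq : ∀ v ∈ A, Γ.graph.Adj t v → v = u) :
    Γ.valencyIn (insert t A) t = 1 ∧ Γ.valencyIn (insert t A) u = Γ.valencyIn A u + 1 ∧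
      ∀ v ∈ A, v ≠ u → Γ.valencyIn (insert t A) v = Γ.valencyIn A v := by
  refine ⟨?_, ?_, fun v hv hvu => ?_⟩
  · rw [valencyIn, Finset.card_eq_one]
    refine ⟨u, ?_⟩
    ext w
    simp only [Finset.mem_filter, Finset.mem_insert, Finset.mem_singleton]
    constructor
    · rintro ⟨rfl | hw, h⟩
      · exact absurd rfl h.ne
      · exact huniq w hw h
    · rintro rfl
      exact ⟨Or.inr hu, htu⟩
  · rw [valencyIn, Finset.filter_insert, if_pos htu.symm, Finset.card_insert_of_notMem]
    · rfl
    · simp [ht]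
  · rw [valencyIn, Finset.filter_insert, if_neg fun h => hvu (huniq v hv h.symm)]
    rfl

variable [Fintype V]

/-- Summing the weights over all extensions of a cycle from `A` eliminates the vertices
outside `A`. -/
theorem IsElliptic.sum_weight_eq_prod (hΓ : Γ.IsElliptic) {S B : Finset V} (hBS : B ⊆ S)
    {l : V → ℤ} (hl : 0 ≤ l) (hlχ : Γ.twoChi l = 0) (hlS : intSupp l = S)
    {X : Finset (V → ℤ)}
    (hX : ∀ r, r ∈ X ↔ Γ.weight r ≠ 0 ∧ (∀ v ∉ B, 0 ≤ r v) ∧ ∃ v, r v < 0)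
    {A : Finset V} (hA : IsLinked Γ.graph A) (hSA : S ⊆ A) {r₀ : V → ℤ}
    (hr₀ : ∀ v ∈ A, v ∉ B → 0 ≤ r₀ v) (hneg : ∃ v ∈ B, r₀ v < 0) :
    ∑ r ∈ X with ∀ v ∈ A, r v = r₀ v, Γ.weight r =
      ∏ v ∈ A, factorCoeff (Γ.valencyIn A v) (Γ.defect (Γ.minExtension A r₀) v) := by
  induction hn : (Finset.univ \ A).card using Nat.strong_induction_on generalizing A r₀ with
  | _ n ih =>
  by_cases hAu : A = Finset.univ
  · subst hAu
    have hmin : Γ.minExtension Finset.univ r₀ = r₀ := by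
      ext v
      exact (hΓ.isLeast_minExtension Finset.univ r₀).1.1 v (Finset.mem_univ v)
    have hfil : (X.filter fun r => ∀ v ∈ Finset.univ, r v = r₀ v) = X.filter (· = r₀) :=
      Finset.filter_congr fun r _ => by simp [funext_iff]
    rw [hmin, hfil, Finset.filter_eq']
    simp only [valencyIn_univ]
    change _ = Γ.weight r₀
    split_ifs with h
    · simp
    · rw [Finset.sum_empty]
      by_contra hw
      exact h ((hX r₀).2 ⟨Ne.symm hw, fun v hv => hr₀ v (Finset.mem_univ v) hv,
        hneg.imp fun v hv => hv.2⟩)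
  · have hBne : B.Nonempty := hneg.imp fun v hv => hv.1
    obtain ⟨u, hu, t, -, ht, hut⟩ := hΓ.isLinked_univ.exists_adj (Finset.subset_univ A)
      (hBne.mono (hBS.trans hSA)) hAu
    have htB : t ∉ B := fun h => ht (hSA (hBS h))
    have hA' : IsLinked Γ.graph (insert t A) := hA.insert hu hut
    obtain ⟨K, htK, hAK, hK⟩ := exists_branch hΓ.isTree.isAcyclic hA ht hu hut.symm
    obtain ⟨hdt, hdu, hdv⟩ := valencyIn_insert ht hu hut.symm fun v hv h =>
      (hK t htK v (hAK v hv) h).2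
    have hl0 : l ≠ 0 := by
      rw [← intSupp_nonempty, hlS]
      exact hBne.mono hBS
    obtain ⟨k, hk0, hkχ, hkA, hk⟩ := hΓ.exists_intSupp_eq hA' hl hl0 hlχ
      (by rw [hlS]; exact hSA.trans (Finset.subset_insert _ _))
    have hkt : k t = 1 := by
      rw [hk t (Finset.mem_insert_self _ _), if_pos]
      have : t ∉ intSupp l := by rw [hlS]; exact fun h => ht (hSA h)
      simpa using this
    obtain ⟨d, hd1, hd2, hd3⟩ := hΓ.defect_minExtension_insert hA hk0 hkχ hkA hkt ht hu
      hut.symm r₀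
    set m := Γ.minExtension A r₀
    set c : ℤ := Γ.defect m u + d
    -- A cutoff for the multiplicity at `t`, beyond all members of `X` and large enough for the
    -- telescoping sum.
    obtain ⟨M, hMd, hMc, hMX⟩ : ∃ M : ℕ, d ≤ M ∧ c < M ∧ ∀ r ∈ X, r t < M := by
      refine ⟨d + c.toNat + 1 + ∑ r ∈ X, (r t).toNat, by omega, by omega, fun r hr => ?_⟩
      have := Finset.single_le_sum (f := fun r : V → ℤ => (r t).toNat)
        (fun _ _ => Nat.zero_le _) hr
      omega
    have hsplit : ∑ r ∈ X with ∀ v ∈ A, r v = r₀ v, Γ.weight r =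
        ∑ a ∈ Finset.range M, ∑ r ∈ X with ∀ v ∈ insert t A,
          r v = Function.update r₀ t (a : ℤ) v, Γ.weight r := by
      rw [← Finset.sum_fiberwise_of_maps_to (t := Finset.range M) (g := fun r => (r t).toNat)]
      · refine Finset.sum_congr rfl fun a _ => Finset.sum_congr ?_ fun _ _ => rfl
        rw [Finset.filter_filter]
        refine Finset.filter_congr fun r hr => ?_
        have hrt : 0 ≤ r t := ((hX r).1 hr).2.1 t htB
        have hupd : ∀ v ∈ A, Function.update r₀ t (a : ℤ) v = r₀ v := fun v hv =>
          Function.update_of_ne (ne_of_mem_of_not_mem hv ht) _ _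
        rw [Finset.forall_mem_insert, Function.update_self, and_comm]
        refine and_congr (by omega) (forall₂_congr fun v hv => by rw [hupd v hv])
      · intro r hr
        have hrX := (Finset.mem_filter.1 hr).1
        have h1 := hMX r hrX
        have h2 : 0 ≤ r t := ((hX r).1 hrX).2.1 t htB
        rw [Finset.mem_range]
        omega
    -- By induction each fibre is a product over `insert t A`. There `t` is an end-vertex, whose
    -- factor is the indicator of `d ≤ a`, and only the factor at `u` still depends on `a`.
    have hterm : ∀ a ∈ Finset.range M, ∑ r ∈ X with ∀ v ∈ insert t A,
          r v = Function.update r₀ t (a : ℤ) v, Γ.weight r =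
        if d ≤ a then factorCoeff (Γ.valencyIn A u + 1) (c - a) *
          ∏ v ∈ A.erase u, factorCoeff (Γ.valencyIn A v) (Γ.defect m v) else 0 := by
      intro a _
      rw [ih _ _ hA' (hSA.trans (Finset.subset_insert _ _)) _ _ rfl, Finset.prod_insert ht,
        ← Finset.mul_prod_erase A _ hu, hdt, factorCoeff_one, hdu, hd3]
      · simp only [hd1]
        split_ifs
        · rw [one_mul]
          congr 1
          refine Finset.prod_congr rfl fun v hv => ?_
          obtain ⟨hvu, hvA⟩ := Finset.mem_erase.1 hv
          rw [hdv v hvA hvu, hd2 a v hvA hvu]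
        · rw [zero_mul]
      · rw [← hn]
        refine Finset.card_lt_card ((Finset.ssubset_iff_of_subset
          (Finset.sdiff_subset_sdiff le_rfl (Finset.subset_insert _ _))).2 ⟨t, ?_, ?_⟩)
        · simp [ht]
        · simp
      · intro v hv hvB
        rcases Finset.mem_insert.1 hv with rfl | h
        · simp
        · rw [Function.update_of_ne (ne_of_mem_of_not_mem h ht)]
          exact hr₀ v h hvB
      · obtain ⟨v, hvB, hv⟩ := hneg
        refine ⟨v, hvB, ?_⟩
        rwa [Function.update_of_ne (ne_of_mem_of_not_mem hvB htB)]
    have hIco : (Finset.range M).filter (fun a => d ≤ a) = Finset.Ico d M := by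
      ext a
      simp only [Finset.mem_filter, Finset.mem_range, Finset.mem_Ico]
      omega
    rw [hsplit, Finset.sum_congr rfl hterm, ← Finset.sum_filter, hIco, ← Finset.sum_mul,
      sum_factorCoeff_succ _ _ _ _ hMd hMc, ← Finset.mul_prod_erase A _ hu]
    congr 2
    simp only [c]
    ring

end

section

variable {V : Type*} [Fintype V] {Γ : PlumbingGraph V}

/-! ### Exponents of the canonical polynomial -/

/-- The negative part of `r` is a canonical cycle if `t ^ (Z_K + r)` occurs in the
Poincaré series. -/
theorem IsElliptic.isCanonical_neg_part (hΓ : Γ.IsElliptic) {r : V → ℤ} (hr : Γ.weight r ≠ 0) :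
    Γ.IsCanonical fun v => max (-r v) 0 := by
  refine hΓ.isCanonical_of_le (fun v => le_max_right _ _) fun v hv => ?_
  have hpos : max (-r v) 0 = -r v := by
    rcases max_choice (-r v) 0 with h | h
    · exact h
    · exact absurd h hv
  have h1 := pair_le_pair (Γ := Γ) (x := -r) (y := fun v => max (-r v) 0) (v := v)
    (by simp [hpos]) fun w _ => le_max_left _ _
  have h2 := defect_nonneg_of_weight_ne_zero hr v
  rw [pair_neg] at h1
  unfold defect at h2
  linarith

theorem weight_fullSubgraph {S : Finset V} (r : S → ℤ) :
    (Γ.fullSubgraph S).weight r =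
      ∏ v ∈ S, factorCoeff (Γ.valencyIn S v) (Γ.defect (extendInt S r) v) := by
  rw [← Finset.prod_coe_sort]
  refine Finset.prod_congr rfl fun v _ => ?_
  rw [valencyIn_coe, defect, defect, pair_fullSubgraph]
  rfl

theorem canonicalPolynomial_coeff (hΓ : Γ.IsResolutionGraph) (l : V → ℤ) :
    (Γ.canonicalPolynomial hΓ).coeff l = Γ.canonicalCoeff l := rfl

theorem truncatedPolynomial_coeff (hΓ : Γ.IsResolutionGraph) (i : ℕ) (l : V → ℤ) :
    (Γ.truncatedPolynomial hΓ i).coeff l =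
      if ∀ v, v ∉ Γ.ellipticSequence i → l v < 0 then Γ.canonicalCoeff l else 0 := by
  rw [truncatedPolynomial, AddMonoidAlgebra.coeff_ofCoeff, Finsupp.filter_apply]
  rfl

theorem reducedPolynomial_coeff {V : Type*} (S : Finset V) (P : AddMonoidAlgebra ℤ (V → ℤ))
    (g : S → ℤ) : (reducedPolynomial S P).coeff g =
      ∑ l ∈ P.coeff.support with (fun v : S => l v) = g, P.coeff l := by
  change (Finsupp.mapDomain (fun l (v : S) => l v) P.coeff) g = _
  rw [Finsupp.mapDomain, Finsupp.sum_apply, Finsupp.sum, Finset.sum_filter]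
  exact Finset.sum_congr rfl fun l _ => Finsupp.single_apply

/-- The exponents of the truncation, in the form `-(l + E)`. -/
theorem mem_image_support_truncatedPolynomial (hΓ : Γ.IsResolutionGraph) (i : ℕ) (r : V → ℤ) :
    r ∈ (Γ.truncatedPolynomial hΓ i).coeff.support.image (fun l => -l - 1) ↔
      Γ.weight r ≠ 0 ∧ (∀ v ∉ Γ.ellipticSequence i, 0 ≤ r v) ∧ ∃ v, r v < 0 := by
  have hinv : ∀ l : V → ℤ, -(-l - 1) - 1 = l := fun l => by abel
  have h1 : r ∈ (Γ.truncatedPolynomial hΓ i).coeff.support.image (fun l => -l - 1) ↔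
      -r - 1 ∈ (Γ.truncatedPolynomial hΓ i).coeff.support := by
    rw [Finset.mem_image]
    constructor
    · rintro ⟨l, hl, rfl⟩
      rwa [hinv]
    · exact fun h => ⟨_, h, hinv r⟩
  have h2 : ∀ v, (-r - 1) v < 0 ↔ 0 ≤ r v := fun v => by
    simp only [Pi.sub_apply, Pi.neg_apply, Pi.one_apply]
    omega
  rw [h1, Finsupp.mem_support_iff, truncatedPolynomial_coeff, canonicalCoeff_eq hΓ.isNegDef, hinv]
  simp only [h2]
  constructor
  · intro h
    split_ifs at h with h3 h4
    · exact absurd rfl h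
    · push Not at h4
      exact ⟨h, h3, h4⟩
    · exact absurd rfl h
  · rintro ⟨h, h3, v, hv⟩
    rwa [if_pos h3, if_neg fun h4 => absurd (h4 v) (not_le.2 hv)]

/-- The substitution `r = -l - E` puts the reduction in the form to which elimination applies. -/
theorem reducedPolynomial_truncatedPolynomial_coeff (hΓ : Γ.IsResolutionGraph) (S : Finset V)
    (i : ℕ) (g : S → ℤ) :
    (reducedPolynomial S (Γ.truncatedPolynomial hΓ i)).coeff g =
      ∑ r ∈ (Γ.truncatedPolynomial hΓ i).coeff.support.image (fun l => -l - 1) with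
        ∀ v ∈ S, r v = extendInt S (-g - 1) v, Γ.weight r := by
  have hinj : Function.Injective fun l : V → ℤ => -l - 1 := fun a b h => by
    simpa using h
  rw [reducedPolynomial_coeff, Finset.filter_image, Finset.sum_image hinj.injOn]
  refine Finset.sum_congr (Finset.filter_congr fun l _ => ?_) fun l hl => ?_
  · constructor
    · rintro rfl v hv
      rw [extendInt_coe _ ⟨v, hv⟩]
      simp
    · intro h
      ext v
      have := h v v.2
      rw [extendInt_coe] at this
      simpa using this
  · have h1 := Finsupp.mem_support_iff.1 (Finset.mem_filter.1 hl).1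
    rw [truncatedPolynomial_coeff, canonicalCoeff_eq hΓ.isNegDef] at h1 ⊢
    split_ifs at h1 ⊢ with h2 h3
    · exact absurd rfl h1
    · rfl
    · exact absurd rfl h1

/-- An exponent of the canonical polynomial which restricts to an exponent of the full subgraph
on `S` is negative outside of the first canonical cycle of this subgraph. -/
theorem IsElliptic.nonneg_of_weight_ne_zero (hΓ : Γ.IsElliptic) {S : Finset V}
    (hS : (Γ.fullSubgraph S).IsElliptic) {x : ℕ → V → ℤ} {y : ℕ → S → ℤ} {i : ℕ}
    (hx : Γ.IsCanonicalChain x) (hy : (Γ.fullSubgraph S).IsCanonicalChain y) (hi : x i ≠ 0)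
    (htail : ∀ t, extendInt S (y t) = x (i + t)) {r : V → ℤ} (hr : Γ.weight r ≠ 0)
    (hrS : (Γ.fullSubgraph S).weight (fun v => r v) ≠ 0) (hneg : ∃ v ∈ S, r v < 0) {v : V}
    (hv : v ∉ intSupp (x i)) : 0 ≤ r v := by
  obtain ⟨u, huS, hu⟩ := hneg
  have hmax : max (-r u) 0 ≠ 0 := by
    rw [max_eq_left (by omega)]
    omega
  obtain ⟨j, hj⟩ := hx.exists_eq (hΓ.isCanonical_neg_part hr) fun h => hmax (congrFun h u)
  obtain ⟨t, ht⟩ := hy.exists_eq (hS.isCanonical_neg_part hrS)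
    fun h => hmax (congrFun h ⟨u, huS⟩)
  -- If `j < i`, then `x j` exceeds `x i` strictly on the support of `x i`, which lies in `S`. But
  -- on `S` it equals `y t`, hence `x (i + t) ≤ x i`.
  have hij : i ≤ j := by
    by_contra! hlt
    obtain ⟨w, hw⟩ := Function.ne_iff.1 hi
    have hwpos : 0 < x i w := lt_of_le_of_ne ((hx.isCanonical i).1 w) (Ne.symm hw)
    have hwS : w ∈ S := by
      by_contra hwS
      have := htail 0
      rw [add_zero] at this
      rw [← this, extendInt_of_notMem _ hwS] at hwpos
      exact lt_irrefl _ hwpos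
    have h1 : x i w ≤ x j w := hx.antitone hlt.le w
    have h2 := hx.lt_of_lt hlt (v := w) (by omega)
    have h3 : x (i + t) w ≤ x i w := hx.antitone (Nat.le_add_right i t) w
    have h4 := congrFun hj w
    have h5 := congrFun ht ⟨w, hwS⟩
    rw [← htail, extendInt_coe (y t) ⟨w, hwS⟩] at h3
    dsimp only at h4 h5
    omega
  have h1 : x j v ≤ x i v := hx.antitone hij v
  have h2 : x i v = 0 := by simpa using hv
  have h3 := congrFun hj v
  have h4 := le_max_left (-r v) 0
  omega

/-! ### Comparison of the reduced truncation with the polynomial of the subgraph. -/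

theorem IsElliptic.exists_intSupp_eq_of_fullSubgraph (hΓ : Γ.IsElliptic) {S : Finset V}
    (hS : (Γ.fullSubgraph S).IsElliptic) :
    ∃ l : V → ℤ, 0 ≤ l ∧ Γ.twoChi l = 0 ∧ intSupp l = S := by
  obtain ⟨l, hl, hlχ⟩ := hS.exists_twoChi_eq_zero
  rw [twoChi_fullSubgraph] at hlχ
  obtain ⟨k, hk, hkχ, hkS, -⟩ := hΓ.exists_intSupp_eq (isLinked_of_fullSubgraph hS.isLinked_univ)
    (by rw [← extendInt_zero S]; exact extendInt_le_iff.2 hl.le)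
    (by
      rw [← extendInt_zero S]
      exact fun h => hl.ne' (extendInt_injective S h)) hlχ
    (fun v hv => by
      by_contra h
      exact mem_intSupp.1 hv (extendInt_of_notMem l h))
  exact ⟨k, hk, hkχ, hkS⟩

/-- If the minimal extension has nonnegative `defect` on `S`, then the weights of the minimal
extension on `S` are those of the full subgraph. -/
theorem IsElliptic.prod_factorCoeff_minExtension (hΓ : Γ.IsElliptic) {S : Finset V}
    (hend : Γ.AttachedAtEndVertices S) (r : S → ℤ)
    (h : ∀ v ∈ S, 0 ≤ Γ.defect (Γ.minExtension S (extendInt S r)) v) :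
    ∏ v ∈ S, factorCoeff (Γ.valencyIn S v) (Γ.defect (Γ.minExtension S (extendInt S r)) v) =
      (Γ.fullSubgraph S).weight r := by
  rw [weight_fullSubgraph]
  have hm := (hΓ.isLeast_minExtension S (extendInt S r)).1
  refine Finset.prod_congr rfl fun v hv => ?_
  by_cases hatt : ∃ w, w ∉ S ∧ Γ.graph.Adj v w
  · have hval : Γ.valencyIn S v = 1 := (valencyIn_coe ⟨v, hv⟩).trans (hend ⟨v, hv⟩ hatt)
    have h1 := h v hv
    -- Replacing the minimal extension by the extension by zero can only raise the defect, so both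
    -- are nonnegative and the end-vertex factor is one in either case.
    have h2 := pair_le_pair (Γ := Γ) (hm.1 v hv).symm fun w _ =>
      show extendInt S r w ≤ Γ.minExtension S (extendInt S r) w by
        by_cases hw : w ∈ S
        · exact (hm.1 w hw).ge
        · rw [extendInt_of_notMem r hw]; exact (hm.2 w hw).1
    have h3 : 0 ≤ Γ.defect (extendInt S r) v := by
      unfold defect at h1 ⊢
      linarith
    rw [hval, factorCoeff_one, factorCoeff_one, if_pos h1, if_pos h3]
  · push Not at hatt
    have : Γ.pair (Γ.minExtension S (extendInt S r)) v = Γ.pair (extendInt S r) v :=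
      pair_congr (hm.1 v hv) fun w hw => by
        by_cases hwS : w ∈ S
        · exact hm.1 w hwS
        · exact absurd hw (hatt w hwS)
    rw [defect, defect, this]

/-- Elimination down to `S` leaves only the signs of the defects of the minimal extension to be
controlled; goodness supplies them. -/
theorem IsElliptic.reducedPolynomial_eq_of_isGoodExtension (hΓ : Γ.IsElliptic) {S : Finset V}
    (hS : (Γ.fullSubgraph S).IsElliptic) (hend : Γ.AttachedAtEndVertices S)
    {x : ℕ → V → ℤ} {y : ℕ → S → ℤ} {i : ℕ} (hx : Γ.IsCanonicalChain x)
    (hy : (Γ.fullSubgraph S).IsCanonicalChain y) (hi : x i ≠ 0)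
    (htail : ∀ t, extendInt S (y t) = x (i + t)) (hseq : Γ.ellipticSequence i = intSupp (x i))
    (hgood : Γ.IsGoodExtension S hΓ.toIsResolutionGraph hS.toIsResolutionGraph) :
    reducedPolynomial S (Γ.truncatedPolynomial hΓ.toIsResolutionGraph i) =
      (Γ.fullSubgraph S).canonicalPolynomial hS.toIsResolutionGraph := by
  refine AddMonoidAlgebra.coeff_injective (Finsupp.ext fun g => ?_)
  set B := intSupp (x i) with hB
  have hBS : B ⊆ S := fun v hv => by
    by_contra h
    have := htail 0
    rw [add_zero] at this
    rw [hB, mem_intSupp, ← this, extendInt_of_notMem _ h] at hv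
    exact hv rfl
  set X := (Γ.truncatedPolynomial hΓ.toIsResolutionGraph i).coeff.support.image
    (fun l => -l - 1) with hXdef
  have hX : ∀ r, r ∈ X ↔ Γ.weight r ≠ 0 ∧ (∀ v ∉ B, 0 ≤ r v) ∧ ∃ v, r v < 0 := fun r => by
    rw [hXdef, mem_image_support_truncatedPolynomial, hseq]
  set ρ : S → ℤ := -g - 1 with hρ
  rw [reducedPolynomial_truncatedPolynomial_coeff, ← hXdef, canonicalPolynomial_coeff,
    canonicalCoeff_eq hS.isNegDef, ← hρ]
  have hgρ : (∀ v, g v < 0) ↔ ∀ v, 0 ≤ ρ v := forall_congr' fun v => by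
    simp only [hρ, Pi.sub_apply, Pi.neg_apply, Pi.one_apply]
    omega
  by_cases hcase : (∀ v ∈ S, v ∉ B → 0 ≤ extendInt S ρ v) ∧ ∃ v ∈ B, extendInt S ρ v < 0
  · obtain ⟨l, hl, hlχ, hlS⟩ := hΓ.exists_intSupp_eq_of_fullSubgraph hS
    rw [hΓ.sum_weight_eq_prod hBS hl hlχ hlS hX (isLinked_of_fullSubgraph hS.isLinked_univ)
      le_rfl hcase.1 hcase.2]
    obtain ⟨b, hbB, hb⟩ := hcase.2
    have hng : ¬ ∀ v, g v < 0 := fun h => by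
      rw [extendInt_coe ρ ⟨b, hBS hbB⟩] at hb
      exact absurd (hgρ.1 h ⟨b, hBS hbB⟩) (not_le.2 hb)
    rw [if_neg hng]
    -- Goodness is not needed in this case: a nonzero product already forces nonnegative defects,
    -- hence equality with the weight zero.
    by_cases hw : (Γ.fullSubgraph S).weight ρ = 0
    · rw [hw]
      by_contra hne
      refine hne ((hΓ.prod_factorCoeff_minExtension hend ρ fun v hv => ?_).trans hw)
      by_contra! hneg
      exact Finset.prod_ne_zero_iff.1 hne v hv (factorCoeff_of_neg _ hneg)
    · refine hΓ.prod_factorCoeff_minExtension hend ρ fun v hv => ?_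
      obtain ⟨l, hl, hlg⟩ := hgood g <| by
        rw [Finsupp.mem_support_iff, canonicalPolynomial_coeff, canonicalCoeff_eq hS.isNegDef,
          if_neg hng]
        exact hw
      have hrρ : ∀ v : S, (-l - 1) (v : V) = ρ v := fun v => by
        simp [hρ, hlg v]
      have hr : Γ.weight (-l - 1) ≠ 0 := by
        rw [Finsupp.mem_support_iff, canonicalPolynomial_coeff, canonicalCoeff_eq hΓ.isNegDef] at hl
        split_ifs at hl
        · exact absurd rfl hl
        · exact hl
      have hmem : -l - 1 ∈ Γ.boundedExtensions (fun v => -2 - Γ.euler v) S (extendInt S ρ) := by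
        refine ⟨fun v hv => ?_, fun v hv => ⟨?_, ?_⟩⟩
        · rw [extendInt_coe ρ ⟨v, hv⟩, ← hrρ]
        · refine hΓ.nonneg_of_weight_ne_zero hS hx hy hi htail hr ?_ ⟨b, hBS hbB, ?_⟩
            fun h => hv (hBS h)
          · rwa [funext hrρ]
          · rwa [extendInt_coe ρ ⟨b, hBS hbB⟩, ← hrρ] at hb
        · have := defect_nonneg_of_weight_ne_zero hr v
          unfold defect at this
          linarith
      have hm := hΓ.isLeast_minExtension S (extendInt S ρ)
      -- The minimal extension lies below the lifted exponent and agrees with it on `S`, so its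
      -- defects on `S` are at least as large.
      have h1 := pair_le_pair (Γ := Γ) ((hm.1.1 v hv).trans (hmem.1 v hv).symm)
        fun w _ => hm.2 hmem w
      have h2 := defect_nonneg_of_weight_ne_zero hr v
      unfold defect at h2 ⊢
      linarith
  · have hleft : (X.filter fun r => ∀ v ∈ S, r v = extendInt S ρ v) = ∅ := by
      refine Finset.filter_eq_empty_iff.2 fun r hr h => hcase ?_
      obtain ⟨-, h1, v, hv⟩ := (hX r).1 hr
      have hvB : v ∈ B := by
        by_contra hvB
        exact absurd (h1 v hvB) (not_le.2 hv)
      exact ⟨fun w hw hwB => h w hw ▸ h1 w hwB, v, hvB, h v (hBS hvB) ▸ hv⟩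
    rw [hleft, Finset.sum_empty]
    -- The right side vanishes too: the negative part of an exponent of the subgraph is some `y t`,
    -- supported in `B`.
    by_contra hne
    split_ifs at hne with hg
    · exact hne rfl
    · rw [hgρ] at hg
      push Not at hg
      obtain ⟨b, hb⟩ := hg
      obtain ⟨t, ht⟩ := hy.exists_eq (hS.isCanonical_neg_part (Ne.symm hne)) fun h => by
        have := congrFun h b
        simp only [Pi.zero_apply] at this
        have := le_max_left (-ρ b) 0
        omega
      have hsupp : ∀ v : S, ρ v < 0 → (v : V) ∈ B := by
        intro v hv
        have h1 : x (i + t) v ≤ x i v := hx.antitone (Nat.le_add_right i t) v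
        have h2 := congrFun ht v
        have h3 := le_max_left (-ρ v) 0
        rw [← htail, extendInt_coe] at h1
        rw [hB, mem_intSupp]
        omega
      refine hcase ⟨fun v hv hvB => ?_, b, hsupp b hb, by rwa [extendInt_coe]⟩
      rw [extendInt_coe ρ ⟨v, hv⟩]
      by_contra! h
      exact hvB (hsupp ⟨v, hv⟩ h)

/-- A nonzero coefficient of the reduction is a sum with a nonzero term, and the exponent of that
term is a lift. -/
theorem isGoodExtension_of_reducedPolynomial_eq {S : Finset V} (hΓ : Γ.IsResolutionGraph)
    (hS : (Γ.fullSubgraph S).IsResolutionGraph) {i : ℕ}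
    (h : reducedPolynomial S (Γ.truncatedPolynomial hΓ i) =
      (Γ.fullSubgraph S).canonicalPolynomial hS) : Γ.IsGoodExtension S hΓ hS := by
  intro g hg
  rw [Finsupp.mem_support_iff, ← h, reducedPolynomial_coeff] at hg
  obtain ⟨l, hl, -⟩ := Finset.exists_ne_zero_of_sum_ne_zero hg
  obtain ⟨hl1, rfl⟩ := Finset.mem_filter.1 hl
  rw [Finsupp.mem_support_iff, truncatedPolynomial_coeff] at hl1
  refine ⟨l, ?_, fun _ => rfl⟩
  rw [Finsupp.mem_support_iff, canonicalPolynomial_coeff]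
  split_ifs at hl1
  · exact hl1
  · exact absurd rfl hl1

end

end PlumbingGraph

end

theorem theorem7p1 {V : Type*} [Fintype V] (Γ : PlumbingGraph V) (S : Finset V)
    (hΓ : Γ.IsElliptic) (hS : (Γ.fullSubgraph S).IsElliptic) (hend : Γ.AttachedAtEndVertices S) :
    (∃! i : ℕ, Γ.IsExtensionIndex S i) ∧
      ∀ i : ℕ, Γ.IsExtensionIndex S i →
        (Γ.IsGoodExtension S hΓ.toIsResolutionGraph hS.toIsResolutionGraph ↔
          PlumbingGraph.reducedPolynomial S
              (Γ.truncatedPolynomial hΓ.toIsResolutionGraph i) =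
            (Γ.fullSubgraph S).canonicalPolynomial hS.toIsResolutionGraph) := by
  obtain ⟨x, y, i, hx, hy, hi, htail, hseq, hindex⟩ := hΓ.exists_isExtensionIndex hS
  refine ⟨⟨i, (hindex i).2 rfl, fun j hj => (hindex j).1 hj⟩, fun j hj => ?_⟩
  obtain rfl := (hindex j).1 hj
  exact ⟨hΓ.reducedPolynomial_eq_of_isGoodExtension hS hend hx hy hi htail (hseq j),
    PlumbingGraph.isGoodExtension_of_reducedPolynomial_eq _ _⟩
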